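/- Let $n\ge 1$ and let $X=(X_t)_{t\ge 0}$, $X_0=0$, be an $n$-dimensional Lévy process with characteristic exponent $\psi:\mathbb{R}^n\to\mathbb{C}$, i.e. $\mathbb{E}\,e^{i\xi\cdot X_t}=e^{-t\psi(\xi)}$ for all $t\ge 0$, $\xi\in\mathbb{R}^n$. Let $\phi:\mathbb{R}^n\to\mathbb{R}$ be the characteristic exponent of a symmetric $n$-dimensional Lévy process (a Lévy process $Y$, $Y_0=0$, such that $Y_t$ and $-Y_t$ have the same law for all $t$), and suppose that $(1+\phi)^{-\kappa/2}\in L_2(\mathbb{R}^n)$ for some $\kappa>0$. Write $C_\infty(\mathbb{R}^n)$ for the continuous functions vanishing at infinity. For $u\in L_1(\mathbb{R}^n)$ and $m\in\mathbb{N}$ let $\phi(D)^m u:=\mathcal{F}^{-1}[\phi^m\cdot\mathcal{F}u]$ in the sense of tempered distributions, where $\mathcal{F}u(\xi)=(2\pi)^{-n}\int u(x)e^{-ix\cdot\xi}\,dx$ and $\mathcal{F}^{-1}w(x)=\int w(\xi)e^{ix\cdot\xi}\,d\xi$. Then the following conditions are equivalent: (a) $\displaystyle\lim_{|\xi|\to\infty}\frac{\operatorname{Re}\psi(\xi)}{\ln(1+\phi(\xi))}=\infty$;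 (b) for all $t>0$ the law of $X_t$ has a density $p_t$ with respect to Lebesgue measure such that $p_t\in C_\infty(\mathbb{R}^n)$ and $\phi(D)^m p_t\in L_1(\mathbb{R}^n)\cap C_\infty(\mathbb{R}^n)$ for all $m\in\mathbb{N}$; (c) for all $t>0$ the law of $X_t$ has a density $p_t$ with respect to Lebesgue measure, and $p_t,\ \phi(D)p_t\in L_1(\mathbb{R}^n)$. -/

import Mathlib

open MeasureTheory ProbabilityTheory Filter Topology
open scoped NNReal ENNReal SchwartzMap

/-- A function `[0,∞) → E` is càdlàg: right-continuous with (finite) left limits. -/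
def IsCadlagPath {E : Type*} [TopologicalSpace E] (x : ℝ≥0 → E) : Prop :=
  (∀ t, ContinuousWithinAt x (Set.Ici t) t) ∧ ∀ t, ∃ l : E, Tendsto x (𝓝[<] t) (𝓝 l)

/-- An `n`-dimensional Lévy process started at `0`: independent and stationary increments and
(almost surely) càdlàg sample paths. -/
structure IsLevyProcess {n : ℕ} {Ω : Type*} [MeasurableSpace Ω]
    (X : ℝ≥0 → Ω → EuclideanSpace ℝ (Fin n)) (P : Measure Ω) : Prop where
  measurable : ∀ t, Measurable (X t)
  start_zero : ∀ᵐ ω ∂P, X 0 ω = 0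
  indep_increments : HasIndepIncrements X P
  stationary_increments : ∀ s t : ℝ≥0, IdentDistrib (fun ω => X (s + t) ω - X s ω) (X t) P P
  cadlag : ∀ᵐ ω ∂P, IsCadlagPath fun t => X t ω

/-- The process is symmetric: `X t` and `-X t` have the same law, for every `t`. -/
def IsSymmetricProcess {n : ℕ} {Ω : Type*} [MeasurableSpace Ω]
    (X : ℝ≥0 → Ω → EuclideanSpace ℝ (Fin n)) (P : Measure Ω) : Prop :=
  ∀ t, IdentDistrib (fun ω => -X t ω) (X t) P P

/-- `ψ` is the characteristic exponent of `X`: `𝔼 exp (i ⟨ξ, X t⟩) = exp (-t ψ(ξ))` for all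
`t ≥ 0` and all `ξ`. -/
def IsCharExponent {n : ℕ} {Ω : Type*} [MeasurableSpace Ω]
    (X : ℝ≥0 → Ω → EuclideanSpace ℝ (Fin n)) (P : Measure Ω)
    (ψ : EuclideanSpace ℝ (Fin n) → ℂ) : Prop :=
  ∀ (t : ℝ≥0) (ξ : EuclideanSpace ℝ (Fin n)),
    charFun (P.map (X t)) ξ = Complex.exp (-((t : ℝ) : ℂ) * ψ ξ)

/-- `p` is a density of the law of `X t` with respect to Lebesgue measure. -/
def IsTransitionDensity {n : ℕ} {Ω : Type*} [MeasurableSpace Ω]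
    (X : ℝ≥0 → Ω → EuclideanSpace ℝ (Fin n)) (P : Measure Ω) (t : ℝ≥0)
    (p : EuclideanSpace ℝ (Fin n) → ℝ) : Prop :=
  Measurable p ∧ (∀ x, 0 ≤ p x) ∧
    P.map (X t) = (volume : Measure (EuclideanSpace ℝ (Fin n))).withDensity
      fun x => ENNReal.ofReal (p x)

/-- `f` belongs to `C_∞`: it is continuous and vanishes at infinity. -/
def VanishesContinuously {E F : Type*} [TopologicalSpace E] [TopologicalSpace F] [Zero F]
    (f : E → F) : Prop :=
  Continuous f ∧ Tendsto f (cocompact E) (𝓝 0)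

/-- The Fourier transform `(2π)⁻ⁿ ∫ u(x) exp (-i ⟨x, ξ⟩) dx`. -/
noncomputable def fourierT {n : ℕ} (u : EuclideanSpace ℝ (Fin n) → ℂ)
    (ξ : EuclideanSpace ℝ (Fin n)) : ℂ :=
  (((2 * Real.pi) ^ n : ℝ) : ℂ)⁻¹ *
    ∫ x, u x * Complex.exp (-(Complex.I * ((inner ℝ x ξ : ℝ) : ℂ)))

/-- The inverse Fourier transform `∫ w(ξ) exp (i ⟨ξ, x⟩) dξ`. -/
noncomputable def fourierTInv {n : ℕ} (w : EuclideanSpace ℝ (Fin n) → ℂ)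
    (x : EuclideanSpace ℝ (Fin n)) : ℂ :=
  ∫ ξ, w ξ * Complex.exp (Complex.I * ((inner ℝ ξ x : ℝ) : ℂ))

/-- `g = Φ(D) u` for an integrable function `u`, where `Φ(D) u` is the inverse Fourier transform of
`Φ · (Fourier transform of u)` in the sense of tempered distributions, that is, tested against
Schwartz functions `η` through `⟨Φ(D) u, η⟩ = ∫ Φ(ξ) (fourierT u)(ξ) (fourierTInv η)(ξ) dξ`. -/
def IsMultiplierImage {n : ℕ} (Φ : EuclideanSpace ℝ (Fin n) → ℝ)
    (u g : EuclideanSpace ℝ (Fin n) → ℂ) : Prop :=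
  ∀ η : 𝓢(EuclideanSpace ℝ (Fin n), ℂ),
    Integrable (fun x => g x * η x) ∧
    Integrable (fun ξ => (Φ ξ : ℂ) * fourierT u ξ * fourierTInv (fun y => η y) ξ) ∧
    ∫ x, g x * η x = ∫ ξ, (Φ ξ : ℂ) * fourierT u ξ * fourierTInv (fun y => η y) ξ

/-!
The growth condition says that `exp (-t Re ψ)` beats every power of `1 + φ`, for all `t > 0`.

From (c) to (a): the Fourier transform of `φ(D) p_t` is, up to normalization, `φ exp (-t ψ)`
reflected, so that `φ exp (-t Re ψ)` vanishes at infinity by the Riemann–Lebesgue lemma. As `φ`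
itself tends to infinity (`tendsto_atTop_of_integrable_rpow`), this gives
`log (1 + φ) ≤ t Re ψ` near infinity, for every `t > 0`.

From (a) to (b): the functions `φ ^ m exp (-t ψ)` are integrable, and their inverse Fourier
integrals are the candidates for `φ(D) ^ m p_t`; they are continuous and vanish at infinity. The
point is that they are integrable (`isFourierL1_pow_mul_exp`). If `ψ` and `φ` were smooth, with
derivatives controlled by `1 + Re ψ` and `1 + φ`, all derivatives of `φ ^ m exp (-t ψ)` would be
integrable, and its inverse transform would decay rapidly. This is achieved by mollifying: for an
even smooth probability density `G` supported in the unit ball,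

* `ψ * G` is smooth, and its derivatives of positive order are controlled by `1 + Re ψ`, because
  `|ψ (ξ - η) - ψ ξ| ≤ 2 |ψ (-η)| + Re ψ ξ` (`IsLevyExponent.norm_sub_le`);
* `ψ * G - ψ` is a pointwise limit of Fourier transforms of positive measures of bounded mass, so
  that it and its exponential are Fourier multipliers of `L¹`
  (`IsLevyExponent.exists_isL1Multiplier_mollify_sub`). In terms of the Lévy measure `ν` and
  of the Fourier transform `Ĝ` of `G`, the limit is the transform of `(1 - Ĝ) ν`, plus a constant
  from the Gaussian part: the mollification removes the large jumps, smoothly.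

The representation of `ψ` by a Lévy triplet is not needed, as the laws at times `1 / k` play the
role of the Lévy measure, and Fatou's lemma transfers bounds in `L¹` to the limit `k → ∞`.
-/

/-! ### Characteristic exponents -/

/-- `ψ` is the exponent of a convolution semigroup: for each `t ≥ 0` the function `exp (-t ψ)` is
the characteristic function of a probability measure. -/
def IsLevyExponent {n : ℕ} (ψ : EuclideanSpace ℝ (Fin n) → ℂ) : Prop :=
  ∃ μ : ℝ≥0 → Measure (EuclideanSpace ℝ (Fin n)), (∀ t, IsProbabilityMeasure (μ t)) ∧
    ∀ t ξ, charFun (μ t) ξ = Complex.exp (-((t : ℝ) : ℂ) * ψ ξ)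

theorem IsCharExponent.isLevyExponent {n : ℕ} {Ω : Type*} [MeasurableSpace Ω]
    {X : ℝ≥0 → Ω → EuclideanSpace ℝ (Fin n)} {P : Measure Ω} [IsProbabilityMeasure P]
    {ψ : EuclideanSpace ℝ (Fin n) → ℂ} (hψ : IsCharExponent X P ψ) (hX : IsLevyProcess X P) :
    IsLevyExponent ψ :=
  ⟨fun t => P.map (X t), fun t => Measure.isProbabilityMeasure_map (hX.measurable t).aemeasurable,
    hψ⟩

theorem norm_one_sub_exp_neg_le {z : ℂ} (hz : 0 ≤ z.re) : ‖1 - Complex.exp (-z)‖ ≤ ‖z‖ := by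
  have := (convex_halfSpace_re_le 0).norm_image_sub_le_of_norm_hasDerivWithin_le (𝕜 := ℂ)
    (f := Complex.exp) (f' := Complex.exp) (C := 1) (x := -z) (y := 0)
    (fun x _ => (Complex.hasDerivAt_exp x).hasDerivWithinAt)
    (fun x hx => by simpa [Complex.norm_exp] using hx) (by simpa using hz) (by simp)
  simpa using this

theorem tendsto_mul_one_sub_exp_neg_div (z : ℂ) :
    Tendsto (fun k : ℕ => (k : ℂ) * (1 - Complex.exp (-(z / k)))) atTop (𝓝 z) := by
  have h := (Complex.hasDerivAt_exp 0).tendsto_slope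
  rcases eq_or_ne z 0 with rfl | hz
  · simp
  have h0 : Tendsto (fun k : ℕ => -(z / k)) atTop (𝓝[≠] 0) := by
    refine tendsto_nhdsWithin_iff.2 ⟨?_, ?_⟩
    · simpa using (tendsto_const_div_atTop_nhds_zero_nat z).neg
    · filter_upwards [eventually_gt_atTop 0] with k hk
      have : (k : ℂ) ≠ 0 := by exact_mod_cast hk.ne'
      simp [hz, this]
  have h1 := (h.comp h0).mul_const z
  simp only [Complex.exp_zero, one_mul] at h1
  refine h1.congr' ?_
  filter_upwards [eventually_gt_atTop 0] with k hk
  have : (k : ℂ) ≠ 0 := by exact_mod_cast hk.ne'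
  simp only [Function.comp, slope_def_field, Complex.exp_zero, sub_zero]
  field_simp
  ring

theorem tendsto_mul_one_sub_exp {n : ℕ} (ψ : EuclideanSpace ℝ (Fin n) → ℂ)
    (ξ : EuclideanSpace ℝ (Fin n)) :
    Tendsto (fun k : ℕ => (k : ℂ) * (1 - Complex.exp (-(((k : ℝ≥0)⁻¹ : ℝ≥0) : ℝ) * ψ ξ))) atTop
      (𝓝 (ψ ξ)) := by
  refine (tendsto_mul_one_sub_exp_neg_div (ψ ξ)).congr fun k => ?_
  congr 4
  push_cast
  rw [div_eq_inv_mul]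
  ring

namespace IsLevyExponent

variable {n : ℕ} {ψ : EuclideanSpace ℝ (Fin n) → ℂ}

theorem norm_exp_le_one (h : IsLevyExponent ψ) (t : ℝ≥0) (ξ : EuclideanSpace ℝ (Fin n)) :
    ‖Complex.exp (-((t : ℝ) : ℂ) * ψ ξ)‖ ≤ 1 := by
  obtain ⟨μ, hμ, hc⟩ := h
  rw [← hc]
  have := hμ t
  exact norm_charFun_le_one ξ

theorem re_nonneg (h : IsLevyExponent ψ) (ξ : EuclideanSpace ℝ (Fin n)) : 0 ≤ (ψ ξ).re := by
  simpa [Complex.norm_exp] using h.norm_exp_le_one 1 ξ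

theorem continuous_exp (h : IsLevyExponent ψ) (t : ℝ≥0) :
    Continuous fun ξ => Complex.exp (-((t : ℝ) : ℂ) * ψ ξ) := by
  obtain ⟨μ, hμ, hc⟩ := h
  have := hμ t
  simp_rw [← hc]
  exact continuous_charFun

/-- The resolvent identity `∫₀^∞ exp (-s (1 + ψ)) ds = (1 + ψ)⁻¹` turns the continuity of the
characteristic functions `exp (-s ψ)` into that of `ψ`, without choosing a branch of logarithm. -/
theorem continuous (h : IsLevyExponent ψ) : Continuous ψ := by
  have hre : ∀ ξ, (-(1 + ψ ξ)).re < 0 := fun ξ => by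
    have := h.re_nonneg ξ
    simp only [Complex.neg_re, Complex.add_re, Complex.one_re]
    linarith
  have hval : ∀ ξ, ∫ s in Set.Ioi (0 : ℝ), Complex.exp (-(1 + ψ ξ) * s) =
      (1 + ψ ξ)⁻¹ := fun ξ => by
    rw [integral_exp_mul_complex_Ioi (hre ξ)]
    simp only [Complex.ofReal_zero, mul_zero, Complex.exp_zero, neg_div_neg_eq, one_div]
  have hcont : Continuous fun ξ => ∫ s in Set.Ioi (0 : ℝ), Complex.exp (-(1 + ψ ξ) * s) := by
    refine continuous_of_dominated (bound := fun s => Real.exp (-s)) ?_ ?_ ?_ ?_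
    · intro ξ
      exact Continuous.aestronglyMeasurable (by fun_prop)
    · intro ξ
      refine (ae_restrict_mem measurableSet_Ioi).mono fun s hs => ?_
      have h1 := h.re_nonneg ξ
      have h2 : (0 : ℝ) < s := hs
      simp only [Complex.norm_exp]
      refine Real.exp_le_exp.2 ?_
      simp
      nlinarith
    · simpa [IntegrableOn] using (integrableOn_exp_mul_Ioi (a := -1) (by norm_num) 0)
    · refine (ae_restrict_mem measurableSet_Ioi).mono fun s hs => ?_
      have h2 : (0 : ℝ) < s := hs
      lift s to ℝ≥0 using h2.le
      have h3 := (h.continuous_exp s).const_mul (Complex.exp (-(s : ℝ)))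
      refine h3.congr fun ξ => ?_
      rw [← Complex.exp_add]
      congr 1
      ring
  simp_rw [hval] at hcont
  have hne : ∀ ξ, 1 + ψ ξ ≠ 0 := fun ξ h0 => by
    have := hre ξ
    simp [h0] at this
  refine ((hcont.inv₀ fun ξ => inv_ne_zero (hne ξ)).sub
    (continuous_const (y := (1 : ℂ)))).congr ?_
  intro ξ
  simp

/-- Almost additivity of an exponent. It is inherited, in the limit `k → ∞`, from
`k |𝔼 (1 - exp (i ⟨a, X⟩)) (1 - exp (i ⟨b, X⟩))| ≤ k Re (1 - f a) + k Re (1 - f b)`, where `f` is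
the characteristic function of the law of `X` at time `1 / k`. -/
theorem norm_add_sub_le (h : IsLevyExponent ψ) (a b : EuclideanSpace ℝ (Fin n)) :
    ‖ψ a + ψ b - ψ (a + b)‖ ≤ (ψ a).re + (ψ b).re := by
  have hT := tendsto_mul_one_sub_exp (n := n) ψ
  have h1 := (((hT a).add (hT b)).sub (hT (a + b))).norm
  have h2 := ((Complex.continuous_re.tendsto _).comp (hT a)).add
    ((Complex.continuous_re.tendsto _).comp (hT b))
  refine le_of_tendsto_of_tendsto' h1 h2 fun k => ?_
  obtain ⟨μ, hμ, hc⟩ := h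
  have := hμ (k : ℝ≥0)⁻¹
  have hint : ∀ c,
      Integrable (fun x => Complex.exp ((inner ℝ x c : ℝ) * Complex.I)) (μ (k : ℝ≥0)⁻¹) :=
    fun c => by
      refine (integrable_const (1 : ℝ)).mono' (Continuous.aestronglyMeasurable (by fun_prop)) ?_
      exact ae_of_all _ fun x => by rw [Complex.norm_exp_ofReal_mul_I]
  simp only [Function.comp, ← hc, ← Complex.add_re, ← mul_add, ← mul_sub, norm_mul,
    ← Complex.ofReal_natCast k, Complex.norm_real, Real.norm_natCast, Complex.re_ofReal_mul]
  set s : ℝ≥0 := (k : ℝ≥0)⁻¹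
  refine mul_le_mul_of_nonneg_left ?_ (Nat.cast_nonneg k)
  set e : EuclideanSpace ℝ (Fin n) → EuclideanSpace ℝ (Fin n) → ℂ :=
    fun c x => Complex.exp ((inner ℝ x c : ℝ) * Complex.I) with he
  have hmul : ∀ x, e (a + b) x = e a x * e b x := fun x => by
    simp only [he, inner_add_right, Complex.ofReal_add, add_mul, Complex.exp_add]
  have hnorm : ∀ c x, ‖e c x‖ = 1 := fun c x => Complex.norm_exp_ofReal_mul_I _
  have hI1 : 1 - charFun (μ s) a + (1 - charFun (μ s) b) - (1 - charFun (μ s) (a + b)) =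
      ∫ x, (1 - e a x) * (1 - e b x) ∂(μ s) := by
    have : ∀ x, (1 - e a x) * (1 - e b x) = 1 - e a x + (1 - e b x) - (1 - e (a + b) x) :=
      fun x => by rw [hmul]; ring
    simp_rw [this]
    have i1 := fun c => (integrable_const (1 : ℂ)).sub (hint c)
    rw [integral_sub, integral_add, integral_sub, integral_sub, integral_sub]
    · simp [charFun_apply, he]
    all_goals first | exact integrable_const _ | exact hint _ | exact i1 _ | exact (i1 _).add (i1 _)
  have hI2 : (1 - charFun (μ s) a + (1 - charFun (μ s) b)).re =
      ∫ x, (1 - (e a x).re + (1 - (e b x).re)) ∂(μ s) := by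
    have i1 : ∀ c, Integrable (fun x => (e c x).re) (μ s) := fun c => (hint c).re
    have i2 : ∀ c, Integrable (fun x => 1 - (e c x).re) (μ s) := fun c =>
      (integrable_const (1 : ℝ)).sub (i1 c)
    have i3 : ∀ c, (charFun (μ s) c).re = ∫ x, (e c x).re ∂(μ s) := fun c =>
      ((integral_re (hint c)).symm)
    rw [integral_add (i2 a) (i2 b), integral_sub (integrable_const _) (i1 a),
      integral_sub (integrable_const _) (i1 b)]
    simp only [Complex.add_re, Complex.sub_re, Complex.one_re, i3]
    simp
  rw [hI1, hI2]
  refine norm_integral_le_of_norm_le ?_ (ae_of_all _ fun x => ?_)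
  · exact ((integrable_const (1 : ℝ)).sub (hint a).re).add
      ((integrable_const (1 : ℝ)).sub (hint b).re)
  · have key : ∀ c, ‖1 - e c x‖ ^ 2 = 2 * (1 - (e c x).re) := fun c => by
      have h1 : (e c x).re ^ 2 + (e c x).im ^ 2 = 1 := by
        have := Complex.sq_norm (e c x)
        rw [hnorm, Complex.normSq_apply] at this
        nlinarith
      rw [Complex.sq_norm, Complex.normSq_apply]
      simp only [Complex.sub_re, Complex.sub_im, Complex.one_re, Complex.one_im]
      nlinarith
    rw [norm_mul]
    nlinarith [key a, key b, sq_nonneg (‖1 - e a x‖ - ‖1 - e b x‖)]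

theorem zero (h : IsLevyExponent ψ) : ψ 0 = 0 := by
  have h1 := h.norm_add_sub_le 0 0
  have h2 := tendsto_mul_one_sub_exp (n := n) ψ 0
  obtain ⟨μ, hμ, hc⟩ := h
  simp only [← hc] at h2
  have h3 : ∀ k : ℕ, charFun (μ ((k : ℝ≥0)⁻¹)) 0 = 1 := fun k => by
    have := hμ ((k : ℝ≥0)⁻¹)
    simp
  simp only [h3, sub_self, mul_zero] at h2
  exact tendsto_nhds_unique h2 tendsto_const_nhds

/-- The oscillation of an exponent over bounded increments is controlled by its real part; the
exponent itself is not, since a drift contributes only to the imaginary part. -/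
theorem norm_sub_le (h : IsLevyExponent ψ) (ξ η : EuclideanSpace ℝ (Fin n)) :
    ‖ψ (ξ - η) - ψ ξ‖ ≤ 2 * ‖ψ (-η)‖ + (ψ ξ).re := by
  have h1 := h.norm_add_sub_le ξ (-η)
  have h2 := Complex.re_le_norm (ψ (-η))
  have h3 : ψ (ξ - η) - ψ ξ = ψ (-η) - (ψ ξ + ψ (-η) - ψ (ξ + -η)) := by
    rw [sub_eq_add_neg ξ η]; ring
  rw [h3]
  exact (_root_.norm_sub_le _ _).trans (by linarith)

theorem re_sub_le (h : IsLevyExponent ψ) (ξ η : EuclideanSpace ℝ (Fin n)) :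
    (ψ (ξ - η)).re ≤ 2 * (ψ ξ).re + 2 * ‖ψ (-η)‖ := by
  have h1 := (Complex.re_le_norm _).trans (h.norm_sub_le ξ η)
  rw [Complex.sub_re] at h1
  linarith

/-- An exponent is bounded on the unit ball. -/
theorem exists_bound (h : IsLevyExponent ψ) :
    ∃ M : ℝ, 0 ≤ M ∧ ∀ η : EuclideanSpace ℝ (Fin n), ‖η‖ ≤ 1 → ‖ψ η‖ ≤ M := by
  obtain ⟨M, hM⟩ := (isCompact_closedBall (0 : EuclideanSpace ℝ (Fin n))
    1).exists_bound_of_continuousOn h.continuous.continuousOn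
  refine ⟨M, (norm_nonneg _).trans (hM 0 (by simp)), fun η hη => hM η (by simpa using hη)⟩

end IsLevyExponent

/-! ### The Fourier transforms with angular frequencies -/

section FourierTransforms

open scoped FourierTransform

variable {n : ℕ} {u w : EuclideanSpace ℝ (Fin n) → ℂ}

theorem fourierTInv_eq (w : EuclideanSpace ℝ (Fin n) → ℂ) (x : EuclideanSpace ℝ (Fin n)) :
    fourierTInv w x = 𝓕⁻ w ((2 * Real.pi)⁻¹ • x) := by
  rw [fourierTInv, Real.fourierInv_eq']
  congr 1 with ξ
  rw [inner_smul_right, mul_inv_cancel_left₀ (by positivity), smul_eq_mul, mul_comm,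
    mul_comm Complex.I]

theorem fourierT_eq (u : EuclideanSpace ℝ (Fin n) → ℂ) (ξ : EuclideanSpace ℝ (Fin n)) :
    fourierT u ξ = (((2 * Real.pi) ^ n : ℝ) : ℂ)⁻¹ * 𝓕 u ((2 * Real.pi)⁻¹ • ξ) := by
  rw [fourierT, Real.fourier_eq']
  congr 2 with x
  rw [inner_smul_right, neg_mul, neg_mul, mul_inv_cancel_left₀ (by positivity), smul_eq_mul,
    mul_comm, mul_comm Complex.I]
  simp

theorem fourierT_eq_fourierTInv_neg (u : EuclideanSpace ℝ (Fin n) → ℂ)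
    (ξ : EuclideanSpace ℝ (Fin n)) :
    fourierT u ξ = (((2 * Real.pi) ^ n : ℝ) : ℂ)⁻¹ * fourierTInv u (-ξ) := by
  rw [fourierT_eq, fourierTInv_eq, smul_neg, Real.fourierInv_eq_fourier_neg, neg_neg]

theorem continuous_fourierTInv (hw : Integrable w) : Continuous (fourierTInv w) := by
  have : Continuous (𝓕 w) :=
    VectorFourier.fourierIntegral_continuous Real.continuous_fourierChar continuous_inner hw
  have h : fourierTInv w = fun x => 𝓕 w (-((2 * Real.pi)⁻¹ • x)) := by
    ext x
    rw [fourierTInv_eq, Real.fourierInv_eq_fourier_neg]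
  rw [h]
  fun_prop

theorem tendsto_fourierTInv (w : EuclideanSpace ℝ (Fin n) → ℂ) :
    Tendsto (fourierTInv w) (cocompact (EuclideanSpace ℝ (Fin n))) (𝓝 0) := by
  have h : fourierTInv w = fun x => 𝓕 w (-((2 * Real.pi)⁻¹ • x)) := by
    ext x
    rw [fourierTInv_eq, Real.fourierInv_eq_fourier_neg]
  have h1 : Tendsto (fun x : EuclideanSpace ℝ (Fin n) => -((2 * Real.pi)⁻¹ • x))
      (cocompact _) (cocompact _) :=
    ((Homeomorph.smulOfNeZero (2 * Real.pi)⁻¹ (by positivity)).trans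
      (Homeomorph.neg _)).isClosedEmbedding.tendsto_cocompact
  rw [h]
  exact (tendsto_integral_exp_inner_smul_cocompact w).comp h1

theorem norm_fourierTInv_le (w : EuclideanSpace ℝ (Fin n) → ℂ) (x : EuclideanSpace ℝ (Fin n)) :
    ‖fourierTInv w x‖ ≤ ∫ ξ, ‖w ξ‖ := by
  refine (norm_integral_le_integral_norm _).trans (le_of_eq ?_)
  congr 1 with ξ
  rw [norm_mul, mul_comm Complex.I, Complex.norm_exp_ofReal_mul_I, mul_one]

theorem integrable_mul_exp_inner (hw : Integrable w) (x : EuclideanSpace ℝ (Fin n)) :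
    Integrable fun ξ => w ξ * Complex.exp (Complex.I * ((inner ℝ ξ x : ℝ) : ℂ)) := by
  refine hw.mul_bdd (c := 1) (Continuous.aestronglyMeasurable (by fun_prop)) ?_
  exact ae_of_all _ fun ξ => by rw [mul_comm Complex.I, Complex.norm_exp_ofReal_mul_I]

theorem fourierTInv_add {v : EuclideanSpace ℝ (Fin n) → ℂ} (hv : Integrable v)
    (hw : Integrable w) :
    fourierTInv (fun ξ => v ξ + w ξ) = fun x => fourierTInv v x + fourierTInv w x := by
  ext x
  simp_rw [fourierTInv, add_mul]
  exact integral_add (integrable_mul_exp_inner hv x) (integrable_mul_exp_inner hw x)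

theorem fourierTInv_const_mul (c : ℂ) (w : EuclideanSpace ℝ (Fin n) → ℂ) :
    fourierTInv (fun ξ => c * w ξ) = fun x => c * fourierTInv w x := by
  ext x
  simp_rw [fourierTInv, mul_assoc]
  exact integral_const_mul _ _

/-- The inverse Fourier transform is its own transpose. -/
theorem integral_fourierTInv_mul (hu : Integrable u) (hw : Integrable w) :
    ∫ x, fourierTInv w x * u x = ∫ ξ, w ξ * fourierTInv u ξ := by
  simp_rw [fourierTInv, ← integral_mul_const, ← integral_const_mul]
  rw [integral_integral_swap]
  · congr 1 with ξ
    congr 1 with x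
    rw [real_inner_comm]
    ring
  · have h1 := hu.mul_prod hw
    refine h1.mono ?_ ?_
    · have : AEStronglyMeasurable (fun p : EuclideanSpace ℝ (Fin n) × EuclideanSpace ℝ (Fin n) =>
          Complex.exp (Complex.I * ((inner ℝ p.2 p.1 : ℝ) : ℂ))) (volume.prod volume) :=
        Continuous.aestronglyMeasurable (by fun_prop)
      refine (h1.aestronglyMeasurable.mul this).congr (ae_of_all _ fun p => ?_)
      simp only [Function.uncurry, Pi.mul_apply]
      ring
    · refine ae_of_all _ fun p => le_of_eq ?_
      simp only [Function.uncurry, norm_mul]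
      rw [mul_comm Complex.I, Complex.norm_exp_ofReal_mul_I]
      ring

end FourierTransforms

/-! ### Fourier transforms of integrable functions and their multipliers -/

/-- The continuous integrable functions `w` with integrable inverse Fourier transform. -/
structure IsFourierL1 {n : ℕ} (w : EuclideanSpace ℝ (Fin n) → ℂ) : Prop where
  continuous : Continuous w
  integrable : Integrable w
  integrable_inv : Integrable (fourierTInv w)

namespace IsFourierL1

variable {n : ℕ} {v w : EuclideanSpace ℝ (Fin n) → ℂ}

theorem of_lintegral (hc : Continuous w) (hi : Integrable w)
    (h : ∫⁻ x, ‖fourierTInv w x‖ₑ < ∞) : IsFourierL1 w :=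
  ⟨hc, hi, (continuous_fourierTInv hi).aestronglyMeasurable, h⟩

theorem add (hv : IsFourierL1 v) (hw : IsFourierL1 w) : IsFourierL1 fun ξ => v ξ + w ξ :=
  ⟨hv.1.add hw.1, hv.2.add hw.2, by
    rw [fourierTInv_add hv.2 hw.2]
    exact hv.3.add hw.3⟩

theorem const_mul (c : ℂ) (hw : IsFourierL1 w) : IsFourierL1 fun ξ => c * w ξ :=
  ⟨hw.1.const_mul c, hw.2.const_mul c, by
    rw [fourierTInv_const_mul]
    exact hw.3.const_mul c⟩

theorem sub (hv : IsFourierL1 v) (hw : IsFourierL1 w) : IsFourierL1 fun ξ => v ξ - w ξ := by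
  simpa [sub_eq_add_neg] using hv.add (hw.const_mul (-1))

end IsFourierL1

/-- `θ` is a Fourier multiplier of `L¹`, with norm at most `C`. Only functions with integrable
Fourier transform are tested, so that all transforms are given by integrals. -/
structure IsL1Multiplier {n : ℕ} (θ : EuclideanSpace ℝ (Fin n) → ℂ) (C : ℝ) : Prop where
  continuous : Continuous θ
  norm_le : ∀ ξ, ‖θ ξ‖ ≤ C
  map : ∀ ⦃w : EuclideanSpace ℝ (Fin n) → ℂ⦄, IsFourierL1 w → IsFourierL1 (fun ξ => θ ξ * w ξ)
  lintegral_le : ∀ ⦃w : EuclideanSpace ℝ (Fin n) → ℂ⦄, IsFourierL1 w →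
    ∫⁻ x, ‖fourierTInv (fun ξ => θ ξ * w ξ) x‖ₑ ≤ ENNReal.ofReal C * ∫⁻ x, ‖fourierTInv w x‖ₑ

namespace IsL1Multiplier

variable {n : ℕ} {θ θ' : EuclideanSpace ℝ (Fin n) → ℂ} {C C' : ℝ}

theorem nonneg (h : IsL1Multiplier θ C) : 0 ≤ C := (norm_nonneg _).trans (h.norm_le 0)

theorem of_lintegral_le (hc : Continuous θ) (hn : ∀ ξ, ‖θ ξ‖ ≤ C)
    (hle : ∀ ⦃w : EuclideanSpace ℝ (Fin n) → ℂ⦄, IsFourierL1 w →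
      ∫⁻ x, ‖fourierTInv (fun ξ => θ ξ * w ξ) x‖ₑ ≤
        ENNReal.ofReal C * ∫⁻ x, ‖fourierTInv w x‖ₑ) : IsL1Multiplier θ C :=
  ⟨hc, hn, fun _ hw => .of_lintegral (hc.mul hw.1)
    (hw.2.bdd_mul hc.aestronglyMeasurable (ae_of_all _ hn))
    ((hle hw).trans_lt (ENNReal.mul_lt_top ENNReal.ofReal_lt_top hw.3.2)), hle⟩

theorem mono (h : IsL1Multiplier θ C) (hC : C ≤ C') : IsL1Multiplier θ C' :=
  ⟨h.1, fun ξ => (h.2 ξ).trans hC, h.3, fun _ hw => (h.4 hw).trans (by gcongr)⟩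

theorem const (c : ℂ) : IsL1Multiplier (n := n) (fun _ => c) ‖c‖ := by
  refine of_lintegral_le continuous_const (fun _ => le_rfl) fun w _ => ?_
  simp only [fourierTInv_const_mul, enorm_mul]
  rw [lintegral_const_mul' _ _ enorm_ne_top, ofReal_norm]

theorem add (h : IsL1Multiplier θ C) (h' : IsL1Multiplier θ' C') :
    IsL1Multiplier (fun ξ => θ ξ + θ' ξ) (C + C') := by
  refine of_lintegral_le (h.1.add h'.1)
    (fun ξ => (norm_add_le _ _).trans (add_le_add (h.2 ξ) (h'.2 ξ))) fun w hw => ?_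
  simp only [add_mul]
  rw [fourierTInv_add (h.3 hw).2 (h'.3 hw).2, ENNReal.ofReal_add h.nonneg h'.nonneg,
    add_mul]
  refine (lintegral_mono fun x => enorm_add_le _ _).trans ?_
  rw [lintegral_add_left]
  · exact add_le_add (h.4 hw) (h'.4 hw)
  · exact (continuous_fourierTInv (h.3 hw).2).enorm.measurable

theorem mul (h : IsL1Multiplier θ C) (h' : IsL1Multiplier θ' C') :
    IsL1Multiplier (fun ξ => θ ξ * θ' ξ) (C * C') := by
  refine of_lintegral_le (h.1.mul h'.1) (fun ξ => ?_) fun w hw => ?_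
  · rw [norm_mul]
    exact mul_le_mul (h.2 ξ) (h'.2 ξ) (norm_nonneg _) h.nonneg
  · simp only [mul_assoc]
    refine (h.4 (h'.3 hw)).trans ?_
    rw [ENNReal.ofReal_mul h.nonneg, mul_assoc]
    gcongr
    exact h'.4 hw

theorem pow (h : IsL1Multiplier θ C) (k : ℕ) : IsL1Multiplier (fun ξ => θ ξ ^ k) (C ^ k) := by
  induction k with
  | zero => simpa using const (n := n) 1
  | succ k ih => simpa only [pow_succ] using ih.mul h

theorem sum {ι : Type*} (s : Finset ι) {f : ι → EuclideanSpace ℝ (Fin n) → ℂ} {c : ι → ℝ}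
    (h : ∀ i, IsL1Multiplier (f i) (c i)) :
    IsL1Multiplier (fun ξ => ∑ i ∈ s, f i ξ) (∑ i ∈ s, c i) := by
  classical
  induction s using Finset.induction_on with
  | empty => simpa using const (n := n) 0
  | insert a s ha ih => simpa only [Finset.sum_insert ha] using (h a).add ih

/-- Multipliers of norm at most `C` are closed under pointwise convergence to a continuous limit:
the inverse transforms converge pointwise, and Fatou's lemma bounds the norm of the limit. -/
theorem of_tendsto {f : ℕ → EuclideanSpace ℝ (Fin n) → ℂ} (hf : ∀ k, IsL1Multiplier (f k) C)
    (hc : Continuous θ) (hlim : ∀ ξ, Tendsto (fun k => f k ξ) atTop (𝓝 (θ ξ))) :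
    IsL1Multiplier θ C := by
  refine of_lintegral_le hc (fun ξ => le_of_tendsto' (hlim ξ).norm fun k => (hf k).2 ξ)
    fun w hw => ?_
  have hpt : ∀ x, Tendsto (fun k => fourierTInv (fun ξ => f k ξ * w ξ) x) atTop
      (𝓝 (fourierTInv (fun ξ => θ ξ * w ξ) x)) := fun x => by
    refine tendsto_integral_of_dominated_convergence (fun ξ => C * ‖w ξ‖)
      (fun k => (integrable_mul_exp_inner ((hf k).3 hw).2 x).1) (hw.2.norm.const_mul C) ?_ ?_
    · refine fun k => ae_of_all _ fun ξ => ?_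
      rw [norm_mul, mul_comm Complex.I, Complex.norm_exp_ofReal_mul_I, mul_one, norm_mul]
      exact mul_le_mul_of_nonneg_right ((hf k).2 ξ) (norm_nonneg _)
    · exact ae_of_all _ fun ξ => ((hlim ξ).mul_const _).mul_const _
  calc ∫⁻ x, ‖fourierTInv (fun ξ => θ ξ * w ξ) x‖ₑ
      = ∫⁻ x, liminf (fun k => ‖fourierTInv (fun ξ => f k ξ * w ξ) x‖ₑ) atTop :=
        lintegral_congr fun x => (hpt x).enorm.liminf_eq.symm
    _ ≤ liminf (fun k => ∫⁻ x, ‖fourierTInv (fun ξ => f k ξ * w ξ) x‖ₑ) atTop :=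
        lintegral_liminf_le fun k => (continuous_fourierTInv ((hf k).3 hw).2).enorm.measurable
    _ ≤ liminf (fun _ : ℕ => ENNReal.ofReal C * ∫⁻ x, ‖fourierTInv w x‖ₑ) atTop :=
        liminf_le_liminf (Eventually.of_forall fun k => (hf k).4 hw)
    _ = _ := by simp

theorem cexp (h : IsL1Multiplier θ C) :
    IsL1Multiplier (fun ξ => Complex.exp (θ ξ)) (Real.exp C) := by
  have hpart : ∀ N : ℕ, IsL1Multiplier
      (fun ξ => ∑ k ∈ Finset.range N, ((k.factorial : ℂ)⁻¹ * θ ξ ^ k)) (Real.exp C) := fun N => by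
    refine (sum (Finset.range N) fun k => (const (k.factorial : ℂ)⁻¹).mul (h.pow k)).mono ?_
    refine le_trans (le_of_eq ?_) (Real.sum_le_exp_of_nonneg h.nonneg N)
    refine Finset.sum_congr rfl fun k _ => ?_
    rw [norm_inv, Complex.norm_natCast]
    field_simp
  refine of_tendsto hpart (Complex.continuous_exp.comp h.1) fun ξ => ?_
  have := (NormedSpace.expSeries_div_hasSum_exp (θ ξ)).tendsto_sum_nat
  rw [← Complex.exp_eq_exp_ℂ] at this
  refine this.congr fun N => Finset.sum_congr rfl fun k _ => ?_
  rw [div_eq_inv_mul]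

/-- The Fourier transform of a finite measure, here `a • μ`, is a multiplier of norm at most its
mass: it acts by averaging translates. -/
theorem of_measure {μ : Measure (EuclideanSpace ℝ (Fin n))} [IsFiniteMeasure μ]
    {a : EuclideanSpace ℝ (Fin n) → ℝ} (ha : Continuous a) (ha0 : ∀ y, 0 ≤ a y)
    (hai : Integrable a μ) :
    IsL1Multiplier (fun ξ => ∫ y, (a y : ℂ) * Complex.exp (Complex.I * (inner ℝ y ξ : ℝ)) ∂μ)
      (∫ y, a y ∂μ) := by
  have hn : ∀ y ξ : EuclideanSpace ℝ (Fin n),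
      ‖(a y : ℂ) * Complex.exp (Complex.I * (inner ℝ y ξ : ℝ))‖ = a y := fun y ξ => by
    rw [norm_mul, mul_comm Complex.I, Complex.norm_exp_ofReal_mul_I, mul_one, Complex.norm_real,
      Real.norm_of_nonneg (ha0 y)]
  refine of_lintegral_le ?_ ?_ fun w hw => ?_
  · refine continuous_of_dominated (bound := a) ?_ ?_ hai ?_
    · exact fun ξ => Continuous.aestronglyMeasurable (by fun_prop)
    · exact fun ξ => ae_of_all _ fun y => (hn y ξ).le
    · exact ae_of_all _ fun y => by fun_prop
  · refine fun ξ => (norm_integral_le_integral_norm _).trans (le_of_eq ?_)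
    simp_rw [hn]
  · have hF := continuous_fourierTInv hw.2
    have heq : ∀ x, fourierTInv (fun ξ =>
        (∫ y, (a y : ℂ) * Complex.exp (Complex.I * (inner ℝ y ξ : ℝ)) ∂μ) * w ξ) x =
        ∫ y, (a y : ℂ) * fourierTInv w (x + y) ∂μ := fun x => by
      simp_rw [fourierTInv, ← integral_mul_const, ← integral_const_mul]
      rw [integral_integral_swap]
      · congr 1 with y
        congr 1 with ξ
        rw [inner_add_right, Complex.ofReal_add, mul_add, Complex.exp_add, real_inner_comm]
        ring
      · have h1 := hw.2.mul_prod (hai.ofReal (𝕜 := ℂ))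
        refine h1.mono ?_ ?_
        · have : AEStronglyMeasurable
              (fun p : EuclideanSpace ℝ (Fin n) × EuclideanSpace ℝ (Fin n) =>
                Complex.exp (Complex.I * (inner ℝ p.2 p.1 : ℝ)) *
                  Complex.exp (Complex.I * (inner ℝ p.1 x : ℝ))) (volume.prod μ) :=
            Continuous.aestronglyMeasurable (by fun_prop)
          refine (h1.aestronglyMeasurable.mul this).congr (ae_of_all _ fun p => ?_)
          simp only [Function.uncurry, Pi.mul_apply]
          simp
          ring
        · refine ae_of_all _ fun p => le_of_eq ?_
          simp only [Function.uncurry, norm_mul]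
          rw [mul_comm Complex.I, Complex.norm_exp_ofReal_mul_I, mul_comm Complex.I,
            Complex.norm_exp_ofReal_mul_I]
          simp
          ring
    have hmass : ∫⁻ y, ‖(a y : ℂ)‖ₑ ∂μ = ENNReal.ofReal (∫ y, a y ∂μ) := by
      rw [ofReal_integral_eq_lintegral_ofReal hai (ae_of_all _ ha0)]
      refine lintegral_congr fun y => ?_
      rw [← ofReal_norm, Complex.norm_real, Real.norm_of_nonneg (ha0 y)]
    calc ∫⁻ x, ‖fourierTInv (fun ξ =>
          (∫ y, (a y : ℂ) * Complex.exp (Complex.I * (inner ℝ y ξ : ℝ)) ∂μ) * w ξ) x‖ₑ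
        = ∫⁻ x, ‖∫ y, (a y : ℂ) * fourierTInv w (x + y) ∂μ‖ₑ := by simp_rw [heq]
      _ ≤ ∫⁻ x, ∫⁻ y, ‖(a y : ℂ)‖ₑ * ‖fourierTInv w (x + y)‖ₑ ∂μ :=
          lintegral_mono fun x => (enorm_integral_le_lintegral_enorm _).trans
            (le_of_eq (by simp_rw [enorm_mul]))
      _ = ∫⁻ y, (∫⁻ x, ‖(a y : ℂ)‖ₑ * ‖fourierTInv w (x + y)‖ₑ) ∂μ :=
          lintegral_lintegral_swap (Continuous.aemeasurable (by
            simp only [← enorm_mul, Function.uncurry_def]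
            fun_prop))
      _ = ∫⁻ y, ‖(a y : ℂ)‖ₑ * (∫⁻ x, ‖fourierTInv w x‖ₑ) ∂μ := by
          refine lintegral_congr fun y => ?_
          rw [lintegral_const_mul' _ _ enorm_ne_top,
            lintegral_add_right_eq_self (fun x => ‖fourierTInv w x‖ₑ) y]
      _ = ENNReal.ofReal (∫ y, a y ∂μ) * ∫⁻ x, ‖fourierTInv w x‖ₑ := by
          rw [lintegral_mul_const' _ _ hw.3.2.ne, hmass]

end IsL1Multiplier

/-! ### Smooth functions with dominated derivatives -/

/-- `f` is smooth and each of its derivatives is bounded by a constant multiple of `B`. -/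
structure HasSymbolBound {n : ℕ} (f : EuclideanSpace ℝ (Fin n) → ℂ)
    (B : EuclideanSpace ℝ (Fin n) → ℝ) : Prop where
  contDiff : ContDiff ℝ (⊤ : ℕ∞) f
  bound : ∀ i : ℕ, ∃ C : ℝ, ∀ ξ, ‖iteratedFDeriv ℝ i f ξ‖ ≤ C * B ξ

theorem norm_iteratedFDeriv_cexp_le (i : ℕ) (z : ℂ) :
    ‖iteratedFDeriv ℝ i Complex.exp z‖ ≤ ‖Complex.exp z‖ := by
  induction i with
  | zero => rw [norm_iteratedFDeriv_zero]
  | succ i ih =>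
    have h : fderiv ℝ Complex.exp = ContinuousLinearMap.mul ℝ ℂ ∘ Complex.exp := by
      ext1 w
      rw [((Complex.hasDerivAt_exp w).hasFDerivAt.restrictScalars ℝ).fderiv]
      ext
      simp [mul_comm]
    rw [← norm_iteratedFDeriv_fderiv, h]
    refine ((ContinuousLinearMap.mul ℝ ℂ).norm_iteratedFDeriv_comp_left
      (Complex.contDiff_exp (n := i)).contDiffAt le_rfl).trans ?_
    exact (mul_le_of_le_one_left (norm_nonneg _) (ContinuousLinearMap.opNorm_mul_le ℝ ℂ)).trans ih

namespace HasSymbolBound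

variable {n : ℕ} {f g : EuclideanSpace ℝ (Fin n) → ℂ} {A B D : EuclideanSpace ℝ (Fin n) → ℝ}

theorem mul (hf : HasSymbolBound f A) (hg : HasSymbolBound g B) :
    HasSymbolBound (fun ξ => f ξ * g ξ) (fun ξ => A ξ * B ξ) := by
  refine ⟨hf.1.mul hg.1, fun i => ?_⟩
  choose C hC using hf.2
  choose C' hC' using hg.2
  refine ⟨∑ j ∈ Finset.range (i + 1), (i.choose j : ℝ) * C j * C' (i - j), fun ξ => ?_⟩
  refine (norm_iteratedFDeriv_mul_le hf.1 hg.1 ξ (n := i) (by exact_mod_cast le_top)).trans ?_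
  rw [Finset.sum_mul]
  refine Finset.sum_le_sum fun j _ => ?_
  calc (i.choose j : ℝ) * ‖iteratedFDeriv ℝ j f ξ‖ * ‖iteratedFDeriv ℝ (i - j) g ξ‖
      = (i.choose j : ℝ) * (‖iteratedFDeriv ℝ j f ξ‖ * ‖iteratedFDeriv ℝ (i - j) g ξ‖) := by ring
    _ ≤ (i.choose j : ℝ) * ((C j * A ξ) * (C' (i - j) * B ξ)) := by
        gcongr
        · exact (norm_nonneg _).trans (hC j ξ)
        · exact hC j ξ
        · exact hC' (i - j) ξ
    _ = _ := by ring

/-- Faà di Bruno: if the derivatives of `f` of positive order are dominated by `D ≥ 1`, those of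
`exp ∘ f` are dominated by powers of `D` times `exp ∘ f`. -/
theorem cexp (hf : ContDiff ℝ (⊤ : ℕ∞) f) (hD : ∀ ξ, 1 ≤ D ξ)
    (hfD : ∀ i : ℕ, 1 ≤ i → ∃ C : ℝ, ∀ ξ, ‖iteratedFDeriv ℝ i f ξ‖ ≤ C * D ξ)
    (hB : ∀ i : ℕ, ∃ C : ℝ, ∀ ξ, ‖Complex.exp (f ξ)‖ * D ξ ^ i ≤ C * B ξ) :
    HasSymbolBound (fun ξ => Complex.exp (f ξ)) B := by
  refine ⟨Complex.contDiff_exp.comp hf, fun m => ?_⟩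
  have : ∀ i : ℕ, ∃ C : ℝ, 1 ≤ i → ∀ ξ, ‖iteratedFDeriv ℝ i f ξ‖ ≤ C * D ξ := fun i => by
    by_cases hi : 1 ≤ i
    · exact (hfD i hi).imp fun _ h _ => h
    · exact ⟨0, fun h => absurd h hi⟩
  choose C hC using this
  obtain ⟨C', hC'⟩ := hB m
  set K : ℝ := 1 + ∑ i ∈ Finset.range (m + 1), |C i| with hK
  have hK1 : 1 ≤ K := le_add_of_nonneg_right (Finset.sum_nonneg fun i _ => abs_nonneg _)
  have hCK : ∀ i ≤ m, C i ≤ K := fun i hi => by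
    have := Finset.single_le_sum (f := fun i => |C i|) (fun i _ => abs_nonneg (C i))
      (Finset.mem_range.2 (Nat.lt_succ_of_le hi))
    exact (le_abs_self _).trans (by linarith)
  refine ⟨m.factorial * K ^ m * C', fun ξ => ?_⟩
  have h1 := norm_iteratedFDeriv_comp_le (n := m) (N := (⊤ : ℕ∞)) (C := ‖Complex.exp (f ξ)‖)
    (D := K * D ξ)
    Complex.contDiff_exp hf (by exact_mod_cast le_top) ξ
    (fun i _ => norm_iteratedFDeriv_cexp_le i (f ξ)) (fun i hi him => by
      refine (hC i hi ξ).trans ?_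
      refine (mul_le_mul_of_nonneg_right (hCK i him) (zero_le_one.trans (hD ξ))).trans ?_
      refine le_self_pow₀ ?_ (by omega)
      exact one_le_mul_of_one_le_of_one_le hK1 (hD ξ))
  refine h1.trans ?_
  calc (m.factorial : ℝ) * ‖Complex.exp (f ξ)‖ * (K * D ξ) ^ m
      = m.factorial * K ^ m * (‖Complex.exp (f ξ)‖ * D ξ ^ m) := by rw [mul_pow]; ring
    _ ≤ m.factorial * K ^ m * (C' * B ξ) :=
        mul_le_mul_of_nonneg_left (hC' ξ) (by positivity)
    _ = _ := by ring

/-- Integrable derivatives of all orders make the Fourier transform decay fast enough to be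
integrable. -/
theorem isFourierL1 (hf : HasSymbolBound f B) (hB : Integrable B) : IsFourierL1 f := by
  have hint : ∀ i : ℕ, Integrable fun ξ => ‖iteratedFDeriv ℝ i f ξ‖ := fun i => by
    obtain ⟨C, hC⟩ := hf.2 i
    refine (hB.const_mul C).mono' ?_ (ae_of_all _ fun ξ => ?_)
    · exact (hf.1.continuous_iteratedFDeriv
        (by exact_mod_cast le_top)).norm.aestronglyMeasurable
    · rw [norm_norm]
      exact hC ξ
  have hfi : Integrable f := by
    refine (integrable_norm_iff hf.1.continuous.aestronglyMeasurable).1 ((hint 0).congr ?_)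
    exact ae_of_all _ fun ξ => norm_iteratedFDeriv_zero
  refine ⟨hf.1.continuous, hfi, ?_⟩
  open scoped FourierTransform in
  have hdecay : ∀ i : ℕ, ∃ C : ℝ, ∀ y, ‖y‖ ^ i * ‖𝓕 f y‖ ≤ C := fun i => by
    have h := Real.pow_mul_norm_iteratedFDeriv_fourier_le (K := 0) (N := ⊤) hf.1
      (fun k j hk _ => by
        obtain rfl : k = 0 := by simpa using hk
        simpa using hint j) (k := 0) (n := i) (by simp) (by simp)
    simp only [norm_iteratedFDeriv_zero] at h
    exact ⟨_, h⟩
  open scoped FourierTransform in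
  have hF : Integrable (𝓕 f) := by
    obtain ⟨C₀, h₀⟩ := hdecay 0
    obtain ⟨C₁, h₁⟩ := hdecay (n + 1)
    have hI : Integrable fun y : EuclideanSpace ℝ (Fin n) =>
        2 ^ n * (C₀ + C₁) * (1 + ‖y‖) ^ (-((n + 1 : ℕ) : ℝ)) :=
      (integrable_one_add_norm (by simp)).const_mul _
    refine hI.mono' ?_ (ae_of_all _ fun y => ?_)
    · exact (VectorFourier.fourierIntegral_continuous Real.continuous_fourierChar
        continuous_inner hfi : Continuous (𝓕 f)).aestronglyMeasurable
    · have hpos : 0 < (1 + ‖y‖) ^ (n + 1) := by positivity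
      rw [Real.rpow_neg (by positivity), Real.rpow_natCast, ← div_eq_mul_inv, le_div_iff₀ hpos]
      have h2 := add_pow_le zero_le_one (norm_nonneg y) (n + 1)
      rw [one_pow, Nat.add_sub_cancel] at h2
      calc ‖𝓕 f y‖ * (1 + ‖y‖) ^ (n + 1)
          ≤ ‖𝓕 f y‖ * (2 ^ n * (1 + ‖y‖ ^ (n + 1))) :=
            mul_le_mul_of_nonneg_left h2 (norm_nonneg _)
        _ = 2 ^ n * (‖y‖ ^ 0 * ‖𝓕 f y‖ + ‖y‖ ^ (n + 1) * ‖𝓕 f y‖) := by ring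
        _ ≤ 2 ^ n * (C₀ + C₁) := by
            gcongr
            · exact h₀ y
            · exact h₁ y
  have h : fourierTInv f = fun x => FourierTransform.fourier f ((-(2 * Real.pi)⁻¹) • x) := by
    ext x
    rw [fourierTInv_eq, Real.fourierInv_eq_fourier_neg, neg_smul]
  rw [h]
  exact hF.comp_smul (neg_ne_zero.2 (by positivity))

end HasSymbolBound

/-! ### Mollification -/

section Mollification

open scoped Convolution

variable {n : ℕ}

/-- An even smooth probability density supported in the unit ball. -/
noncomputable def mollifier (n : ℕ) : EuclideanSpace ℝ (Fin n) → ℝ :=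
  ContDiffBump.normed (c := (0 : EuclideanSpace ℝ (Fin n)))
    ⟨1 / 2, 1, by norm_num, by norm_num⟩ volume

theorem mollifier_nonneg (η : EuclideanSpace ℝ (Fin n)) : 0 ≤ mollifier n η :=
  ContDiffBump.nonneg_normed _ η

theorem mollifier_neg (η : EuclideanSpace ℝ (Fin n)) : mollifier n (-η) = mollifier n η :=
  ContDiffBump.normed_neg _ η

theorem integral_mollifier : ∫ η, mollifier n η = 1 :=
  ContDiffBump.integral_normed _

theorem contDiff_mollifier : ContDiff ℝ (⊤ : ℕ∞) (mollifier n) :=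
  ContDiffBump.contDiff_normed _

theorem continuous_mollifier : Continuous (mollifier n) := contDiff_mollifier.continuous

theorem hasCompactSupport_mollifier : HasCompactSupport (mollifier n) :=
  ContDiffBump.hasCompactSupport_normed _

theorem integrable_mollifier : Integrable (mollifier n) :=
  ContDiffBump.integrable_normed _

theorem tsupport_mollifier :
    tsupport (mollifier n) = Metric.closedBall (0 : EuclideanSpace ℝ (Fin n)) 1 :=
  ContDiffBump.tsupport_normed_eq _

/-- The average of `f` over translates, with weight `mollifier n`. -/
noncomputable def mollify (f : EuclideanSpace ℝ (Fin n) → ℂ) (ξ : EuclideanSpace ℝ (Fin n)) : ℂ :=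
  ∫ η, f (ξ - η) * (mollifier n η : ℂ)

theorem mollify_eq_convolution (f : EuclideanSpace ℝ (Fin n) → ℂ) :
    mollify f = f ⋆[ContinuousLinearMap.mul ℝ ℂ, volume] fun η => (mollifier n η : ℂ) := by
  ext ξ
  rw [convolution_eq_swap]
  rfl

theorem integrable_mul_mollifier {f : EuclideanSpace ℝ (Fin n) → ℂ} (hf : Continuous f)
    (ξ : EuclideanSpace ℝ (Fin n)) : Integrable fun η => f (ξ - η) * (mollifier n η : ℂ) := by
  have h := continuous_mollifier (n := n)
  refine Continuous.integrable_of_hasCompactSupport (by fun_prop) ?_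
  exact (hasCompactSupport_mollifier.comp_left Complex.ofReal_zero).mul_left

theorem norm_mollify_le {f : EuclideanSpace ℝ (Fin n) → ℂ} {ξ : EuclideanSpace ℝ (Fin n)} {b : ℝ}
    (hb : ∀ η : EuclideanSpace ℝ (Fin n), ‖η‖ ≤ 1 → ‖f (ξ - η)‖ ≤ b) : ‖mollify f ξ‖ ≤ b := by
  have h : ‖mollify f ξ‖ ≤ ∫ η, b * mollifier n η := by
    refine norm_integral_le_of_norm_le (integrable_mollifier.const_mul b) (ae_of_all _ fun η => ?_)
    rw [norm_mul, Complex.norm_real, Real.norm_of_nonneg (mollifier_nonneg η)]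
    by_cases hη : ‖η‖ ≤ 1
    · exact mul_le_mul_of_nonneg_right (hb η hη) (mollifier_nonneg η)
    · have : mollifier n η = 0 := image_eq_zero_of_notMem_tsupport (by
        rw [tsupport_mollifier]
        simpa using hη)
      simp [this]
  rwa [integral_const_mul, integral_mollifier, mul_one] at h

theorem mollify_sub_const {f : EuclideanSpace ℝ (Fin n) → ℂ} (hf : Continuous f) (c : ℂ) :
    mollify (fun ξ => f ξ - c) = fun ξ => mollify f ξ - c := by
  ext ξ
  have hG : Integrable fun η => c * (mollifier n η : ℂ) := integrable_mollifier.ofReal.const_mul c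
  simp only [mollify, sub_mul]
  rw [integral_sub (integrable_mul_mollifier hf ξ) hG, integral_const_mul, integral_complex_ofReal,
    integral_mollifier]
  simp

theorem contDiff_mollify {f : EuclideanSpace ℝ (Fin n) → ℂ} (hf : Continuous f) :
    ContDiff ℝ (⊤ : ℕ∞) (mollify f) := by
  rw [mollify_eq_convolution]
  exact HasCompactSupport.contDiff_convolution_right _
    (hasCompactSupport_mollifier.comp_left Complex.ofReal_zero) hf.locallyIntegrable
    (Complex.ofRealCLM.contDiff.comp contDiff_mollifier)

/-- The derivatives of a convolution with a fixed test function are controlled by the size of the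
other factor on the unit ball around the point in question. -/
theorem exists_norm_iteratedFDeriv_convolution_le (i : ℕ) {F F' : Type} [NormedAddCommGroup F]
    [NormedSpace ℝ F] [NormedAddCommGroup F'] [NormedSpace ℝ F'] [CompleteSpace F']
    (L : ℂ →L[ℝ] F →L[ℝ] F') {g : EuclideanSpace ℝ (Fin n) → F} (hg : ContDiff ℝ (⊤ : ℕ∞) g)
    (hgs : tsupport g ⊆ Metric.closedBall 0 1) :
    ∃ C : ℝ, ∀ f : EuclideanSpace ℝ (Fin n) → ℂ, Continuous f →
      ∀ (ξ : EuclideanSpace ℝ (Fin n)) (b : ℝ),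
        (∀ η : EuclideanSpace ℝ (Fin n), ‖η‖ ≤ 1 → ‖f (ξ - η)‖ ≤ b) →
        ‖iteratedFDeriv ℝ i (f ⋆[L, volume] g) ξ‖ ≤ C * b := by
  have hcs : ∀ {F₀ : Type} [NormedAddCommGroup F₀] {g₀ : EuclideanSpace ℝ (Fin n) → F₀},
      tsupport g₀ ⊆ Metric.closedBall 0 1 → HasCompactSupport g₀ := fun h =>
    (isCompact_closedBall _ _).of_isClosed_subset (isClosed_tsupport _) h
  induction i generalizing F F' with
  | zero =>
    refine ⟨‖L‖ * ∫ η, ‖g η‖, fun f hf ξ b hb => ?_⟩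
    rw [norm_iteratedFDeriv_zero, convolution_eq_swap, ← integral_const_mul, ← integral_mul_const]
    have hgi : Integrable g := hg.continuous.integrable_of_hasCompactSupport (hcs hgs)
    refine norm_integral_le_of_norm_le ((hgi.norm.const_mul _).mul_const _)
      (ae_of_all _ fun η => ?_)
    by_cases hη : ‖η‖ ≤ 1
    · calc ‖L (f (ξ - η)) (g η)‖ ≤ ‖L‖ * ‖f (ξ - η)‖ * ‖g η‖ := L.le_opNorm₂ _ _
        _ ≤ ‖L‖ * b * ‖g η‖ := by gcongr; exact hb η hη
        _ = _ := by ring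
    · have : g η = 0 := image_eq_zero_of_notMem_tsupport fun h => hη (by simpa using hgs h)
      simp [this]
  | succ i ih =>
    obtain ⟨C, hC⟩ := ih (L.precompR (EuclideanSpace ℝ (Fin n)))
      (hg.fderiv_right (m := (⊤ : ℕ∞)) (by simp)) ((tsupport_fderiv_subset ℝ).trans hgs)
    refine ⟨C, fun f hf ξ b hb => ?_⟩
    have hd : fderiv ℝ (f ⋆[L, volume] g) =
        f ⋆[L.precompR (EuclideanSpace ℝ (Fin n)), volume] fderiv ℝ g := by
      ext1 x
      exact ((hcs hgs).hasFDerivAt_convolution_right L hf.locallyIntegrable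
        (hg.of_le (by exact_mod_cast le_top)) x).fderiv
    rw [← norm_iteratedFDeriv_fderiv, hd]
    exact hC f hf ξ b hb

theorem exists_norm_iteratedFDeriv_mollify_le (i : ℕ) :
    ∃ C : ℝ, ∀ f : EuclideanSpace ℝ (Fin n) → ℂ, Continuous f →
      ∀ (ξ : EuclideanSpace ℝ (Fin n)) (b : ℝ),
        (∀ η : EuclideanSpace ℝ (Fin n), ‖η‖ ≤ 1 → ‖f (ξ - η)‖ ≤ b) →
        ‖iteratedFDeriv ℝ i (mollify f) ξ‖ ≤ C * b := by
  simp only [mollify_eq_convolution]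
  refine exists_norm_iteratedFDeriv_convolution_le i _
    (Complex.ofRealCLM.contDiff.comp contDiff_mollifier) ?_
  refine (closure_mono fun η hη => ?_).trans tsupport_mollifier.subset
  simpa using hη

end Mollification

/-! ### Mollified exponents -/

section MollifiedExponent

variable {n : ℕ} {ψ : EuclideanSpace ℝ (Fin n) → ℂ}

theorem integral_mollifier_mul_exp (y : EuclideanSpace ℝ (Fin n)) :
    ∫ η, (mollifier n η : ℂ) * Complex.exp (-(Complex.I * (inner ℝ y η : ℝ))) =
      ((∫ η, mollifier n η * Real.cos (inner ℝ y η) : ℝ) : ℂ) := by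
  have hc := continuous_mollifier (n := n)
  have hcos : Integrable fun η => mollifier n η * Real.cos (inner ℝ y η) :=
    integrable_mollifier.mul_bdd (c := 1) (Continuous.aestronglyMeasurable (by fun_prop))
      (ae_of_all _ fun η => Real.abs_cos_le_one _)
  have hsin : Integrable fun η => mollifier n η * Real.sin (inner ℝ y η) :=
    integrable_mollifier.mul_bdd (c := 1) (Continuous.aestronglyMeasurable (by fun_prop))
      (ae_of_all _ fun η => Real.abs_sin_le_one _)
  -- The sine part is the integral of an odd function.
  have hodd : ∫ η, mollifier n η * Real.sin (inner ℝ y η) = 0 := by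
    have h := integral_neg_eq_self (fun η => mollifier n η * Real.sin (inner ℝ y η)) volume
    simp only [mollifier_neg, inner_neg_right, Real.sin_neg, mul_neg, integral_neg] at h
    linarith
  have h : ∀ η, (mollifier n η : ℂ) * Complex.exp (-(Complex.I * (inner ℝ y η : ℝ))) =
      ((mollifier n η * Real.cos (inner ℝ y η) : ℝ) : ℂ) -
        ((mollifier n η * Real.sin (inner ℝ y η) : ℝ) : ℂ) * Complex.I := fun η => by
    rw [← mul_neg, ← Complex.ofReal_neg, mul_comm Complex.I, Complex.exp_mul_I,
      ← Complex.ofReal_cos, ← Complex.ofReal_sin, Real.cos_neg, Real.sin_neg]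
    push_cast
    ring
  simp_rw [h]
  rw [integral_sub hcos.ofReal (hsin.ofReal.mul_const _), integral_mul_const,
    integral_complex_ofReal, integral_complex_ofReal, hodd]
  simp

theorem mollify_charFun (μ : Measure (EuclideanSpace ℝ (Fin n))) [IsFiniteMeasure μ]
    (ξ : EuclideanSpace ℝ (Fin n)) :
    mollify (charFun μ) ξ = ∫ y, ((∫ η, mollifier n η * Real.cos (inner ℝ y η) : ℝ) : ℂ) *
      Complex.exp (Complex.I * (inner ℝ y ξ : ℝ)) ∂μ := by
  have hc := continuous_mollifier (n := n)
  simp_rw [← integral_mollifier_mul_exp, mollify, charFun_apply, ← integral_mul_const]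
  rw [integral_integral_swap]
  · congr 1 with y
    congr 1 with η
    rw [inner_sub_right, Complex.ofReal_sub, sub_mul, sub_eq_add_neg, Complex.exp_add,
      mul_comm Complex.I, mul_comm Complex.I]
    ring
  · have h1 : Integrable (fun p : EuclideanSpace ℝ (Fin n) × EuclideanSpace ℝ (Fin n) =>
        mollifier n p.1 * (1 : ℝ)) (volume.prod μ) :=
      integrable_mollifier.mul_prod (integrable_const 1)
    refine h1.mono (Continuous.aestronglyMeasurable ?_) (ae_of_all _ fun p => le_of_eq ?_)
    · simp only [Function.uncurry_def]
      fun_prop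
    · simp only [Function.uncurry, norm_mul]
      rw [Complex.norm_exp_ofReal_mul_I, Complex.norm_real]
      simp

/-- Mollifying an exponent changes it by the Fourier transform of a finite measure, up to a
constant. For a characteristic function `f` of a law `μ`, `k (f - mollify f)` is the
Fourier transform of the positive measure `k (1 - c) • μ`, where `c` is the cosine transform of the
mollifier. With `f = exp (-ψ / k)` these functions tend to `mollify ψ - ψ`, and their masses, which
are their values at `0`, stay bounded. -/
theorem IsLevyExponent.exists_isL1Multiplier_mollify_sub (h : IsLevyExponent ψ) :
    ∃ M : ℝ, IsL1Multiplier (fun ξ => mollify ψ ξ - ψ ξ) M := by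
  obtain ⟨M, -, hM⟩ := h.exists_bound
  refine ⟨M, ?_⟩
  have hψ0 := h.zero
  have hcont := h.continuous
  have hre := h.re_nonneg
  have hlim := tendsto_mul_one_sub_exp ψ
  obtain ⟨μ, hμ, hc⟩ := h
  simp only [← hc] at hlim
  set ν : ℕ → Measure (EuclideanSpace ℝ (Fin n)) := fun k => μ (k : ℝ≥0)⁻¹ with hν
  have hνp : ∀ k, IsProbabilityMeasure (ν k) := fun k => hμ _
  set Ψ : ℕ → EuclideanSpace ℝ (Fin n) → ℂ := fun k ξ => (k : ℂ) * (1 - charFun (ν k) ξ) with hΨ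
  have hΨc : ∀ k, Continuous (Ψ k) := fun k => by
    have : Continuous (charFun (ν k)) := continuous_charFun
    fun_prop
  have hΨle : ∀ k ξ, ‖Ψ k ξ‖ ≤ ‖ψ ξ‖ := fun k ξ => by
    have h1 : charFun (ν k) ξ = Complex.exp (-((((k : ℝ)⁻¹ : ℝ) : ℂ) * ψ ξ)) := by
      rw [hν]
      simp only [hc]
      push_cast
      rw [neg_mul]
    have h2 : 0 ≤ ((((k : ℝ)⁻¹ : ℝ) : ℂ) * ψ ξ).re := by
      rw [Complex.re_ofReal_mul]
      exact mul_nonneg (by positivity) (hre ξ)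
    simp only [hΨ, norm_mul, h1, Complex.norm_natCast]
    refine (mul_le_mul_of_nonneg_left (norm_one_sub_exp_neg_le h2) (Nat.cast_nonneg k)).trans ?_
    rw [norm_mul, Complex.norm_real, Real.norm_of_nonneg (by positivity), ← mul_assoc]
    refine mul_le_of_le_one_left (norm_nonneg _) ?_
    exact mul_inv_le_one
  refine IsL1Multiplier.of_tendsto (f := fun k ξ => mollify (Ψ k) ξ - Ψ k ξ) (fun k => ?_)
    ((contDiff_mollify hcont).continuous.sub hcont) fun ξ => ?_
  · set c : EuclideanSpace ℝ (Fin n) → ℝ := fun y =>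
      ∫ η, mollifier n η * Real.cos (inner ℝ y η) with hcdef
    have hmc := continuous_mollifier (n := n)
    have hbd : ∀ y η : EuclideanSpace ℝ (Fin n),
        ‖mollifier n η * Real.cos (inner ℝ y η)‖ ≤ mollifier n η := fun y η => by
      rw [norm_mul, Real.norm_of_nonneg (mollifier_nonneg η)]
      exact mul_le_of_le_one_right (mollifier_nonneg η) (Real.abs_cos_le_one _)
    have hcc : Continuous c := by
      refine continuous_of_dominated (bound := mollifier n) ?_ ?_ integrable_mollifier ?_
      · exact fun y => Continuous.aestronglyMeasurable (by fun_prop)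
      · exact fun y => ae_of_all _ (hbd y)
      · exact ae_of_all _ fun η => by fun_prop
    have hc1 : ∀ y, ‖c y‖ ≤ 1 := fun y => by
      have := norm_integral_le_of_norm_le integrable_mollifier (ae_of_all _ (hbd y))
      rwa [integral_mollifier] at this
    set a : EuclideanSpace ℝ (Fin n) → ℝ := fun y => k * (1 - c y) with hadef
    have ha : Continuous a := by fun_prop
    have ha0 : ∀ y, 0 ≤ a y := fun y =>
      mul_nonneg (Nat.cast_nonneg k) (sub_nonneg.2 ((le_abs_self _).trans (hc1 y)))
    have hci : Integrable c (ν k) :=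
      (integrable_const (1 : ℝ)).mono' hcc.aestronglyMeasurable (ae_of_all _ hc1)
    have hai : Integrable a (ν k) := ((integrable_const (1 : ℝ)).sub hci).const_mul _
    have hei : ∀ ξ : EuclideanSpace ℝ (Fin n),
        Integrable (fun y => Complex.exp (Complex.I * (inner ℝ y ξ : ℝ))) (ν k) := fun ξ => by
      refine (integrable_const (1 : ℝ)).mono' (Continuous.aestronglyMeasurable (by fun_prop)) ?_
      exact ae_of_all _ fun y => by rw [mul_comm, Complex.norm_exp_ofReal_mul_I]
    have heq : ∀ ξ, mollify (Ψ k) ξ - Ψ k ξ =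
        ∫ y, (a y : ℂ) * Complex.exp (Complex.I * (inner ℝ y ξ : ℝ)) ∂(ν k) := fun ξ => by
      have hcf : Continuous (charFun (ν k)) := continuous_charFun
      have h1 : mollify (Ψ k) ξ = (k : ℂ) * (1 - mollify (charFun (ν k)) ξ) := by
        have : Ψ k = fun ξ => -(k : ℂ) * charFun (ν k) ξ - -(k : ℂ) := by
          ext ξ
          simp only [hΨ]
          ring
        rw [this, mollify_sub_const (by fun_prop)]
        simp only [mollify, mul_assoc, integral_const_mul]
        ring
      have h2 : charFun (ν k) ξ = ∫ y, Complex.exp (Complex.I * (inner ℝ y ξ : ℝ)) ∂(ν k) := by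
        simp_rw [charFun_apply, mul_comm Complex.I]
      have h3 : Integrable (fun y => (c y : ℂ) * Complex.exp (Complex.I * (inner ℝ y ξ : ℝ)))
          (ν k) := by
        refine (hei ξ).bdd_mul (c := 1) (Continuous.aestronglyMeasurable (by fun_prop)) ?_
        exact ae_of_all _ fun y => by
          rw [Complex.norm_real]
          exact hc1 y
      simp only [hΨ] at h1 ⊢
      rw [h1, mollify_charFun, h2]
      simp only [hadef, Complex.ofReal_mul, Complex.ofReal_sub, Complex.ofReal_one, mul_assoc,
        sub_mul, one_mul, integral_const_mul, Complex.ofReal_natCast]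
      rw [integral_sub (hei ξ) h3]
      simp only [hcdef]
      ring
    simp_rw [heq]
    refine (IsL1Multiplier.of_measure ha ha0 hai).mono ?_
    -- The mass is the value at `0` of the transform.
    have h0 : ((∫ y, a y ∂(ν k) : ℝ) : ℂ) = mollify (Ψ k) 0 := by
      have h1 := heq 0
      have h2 : Ψ k 0 = 0 := by simpa [hψ0] using hΨle k 0
      simp only [h2, sub_zero, inner_zero_right, Complex.ofReal_zero, mul_zero, Complex.exp_zero,
        mul_one, integral_complex_ofReal] at h1
      exact h1.symm
    calc ∫ y, a y ∂(ν k) ≤ ‖((∫ y, a y ∂(ν k) : ℝ) : ℂ)‖ := by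
          rw [Complex.norm_real]
          exact le_abs_self _
      _ ≤ M := by
          rw [h0]
          refine norm_mollify_le fun η hη => (hΨle k _).trans (hM _ ?_)
          simpa using hη
  · refine Tendsto.sub ?_ (hlim ξ)
    refine tendsto_integral_of_dominated_convergence
      (fun η => ‖ψ (ξ - η) * (mollifier n η : ℂ)‖)
      (fun k => (integrable_mul_mollifier (hΨc k) ξ).1) (integrable_mul_mollifier hcont ξ).norm
      (fun k => ae_of_all _ fun η => ?_) (ae_of_all _ fun η => (hlim _).mul_const _)
    change ‖Ψ k (ξ - η) * (mollifier n η : ℂ)‖ ≤ ‖ψ (ξ - η) * (mollifier n η : ℂ)‖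
    rw [norm_mul (Ψ k _), norm_mul (ψ _)]
    exact mul_le_mul_of_nonneg_right (hΨle k _) (norm_nonneg _)

theorem IsLevyExponent.exists_norm_iteratedFDeriv_mollify_le (h : IsLevyExponent ψ) {i : ℕ}
    (hi : 1 ≤ i) :
    ∃ C : ℝ, ∀ ξ, ‖iteratedFDeriv ℝ i (mollify ψ) ξ‖ ≤ C * (1 + (ψ ξ).re) := by
  obtain ⟨M, hM0, hM⟩ := h.exists_bound
  obtain ⟨C, hC⟩ := _root_.exists_norm_iteratedFDeriv_mollify_le (n := n) i
  refine ⟨|C| * (2 * M + 1), fun ξ => ?_⟩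
  have hr := h.re_nonneg ξ
  -- Subtracting the constant `ψ ξ` does not change the derivatives, but removes the drift.
  have h1 := hC (fun η => ψ η - ψ ξ) (h.continuous.sub continuous_const) ξ (2 * M + (ψ ξ).re)
    fun η hη => by
      have h2 := h.norm_sub_le ξ η
      have h3 := hM (-η) ((norm_neg η).trans_le hη)
      linarith
  rw [mollify_sub_const h.continuous] at h1
  have h2 : iteratedFDeriv ℝ i (fun η => mollify ψ η - ψ ξ) ξ =
      iteratedFDeriv ℝ i (mollify ψ) ξ := by
    have h3 := iteratedFDeriv_sub_apply (𝕜 := ℝ) (i := i) (x := ξ) (f := mollify ψ)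
      (g := fun _ => ψ ξ)
      ((contDiff_mollify h.continuous).of_le (by exact_mod_cast le_top)).contDiffAt
      contDiff_const.contDiffAt
    rw [iteratedFDeriv_const_of_ne (by omega)] at h3
    rw [Pi.zero_apply, sub_zero] at h3
    exact h3
  rw [h2] at h1
  refine h1.trans ?_
  calc C * (2 * M + (ψ ξ).re) ≤ |C| * (2 * M + (ψ ξ).re) :=
        mul_le_mul_of_nonneg_right (le_abs_self C) (by positivity)
    _ ≤ |C| * ((2 * M + 1) * (1 + (ψ ξ).re)) :=
        mul_le_mul_of_nonneg_left (by nlinarith [mul_nonneg hM0 hr]) (abs_nonneg C)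
    _ = _ := by ring

theorem IsLevyExponent.hasSymbolBound_exp_mollify (h : IsLevyExponent ψ) {t : ℝ} (ht : 0 < t) :
    HasSymbolBound (fun ξ => Complex.exp (-(t : ℂ) * mollify ψ ξ))
      (fun ξ => Real.exp (-(t / 2) * (ψ ξ).re)) := by
  obtain ⟨M, hM⟩ := h.exists_isL1Multiplier_mollify_sub
  have hcd := contDiff_mollify h.continuous
  refine HasSymbolBound.cexp (D := fun ξ => 1 + (ψ ξ).re) (contDiff_const.mul hcd)
    (fun ξ => le_add_of_nonneg_right (h.re_nonneg ξ)) (fun i hi => ?_) fun i => ?_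
  · obtain ⟨C, hC⟩ := h.exists_norm_iteratedFDeriv_mollify_le hi
    refine ⟨t * C, fun ξ => ?_⟩
    have h1 : iteratedFDeriv ℝ i (fun ξ => -(t : ℂ) * mollify ψ ξ) ξ =
        (-t) • iteratedFDeriv ℝ i (mollify ψ) ξ := by
      rw [← iteratedFDeriv_const_smul_apply (hcd.of_le (by exact_mod_cast le_top)).contDiffAt]
      congr 1
      ext ξ
      simp
    rw [h1, norm_smul, norm_neg, Real.norm_of_nonneg ht.le, mul_assoc]
    exact mul_le_mul_of_nonneg_left (hC ξ) ht.le
  · refine ⟨Real.exp (t * M) * (i.factorial * (2 / t) ^ i * Real.exp (t / 2)), fun ξ => ?_⟩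
    have hr := h.re_nonneg ξ
    have h1 : (ψ ξ).re - M ≤ (mollify ψ ξ).re := by
      have := (Complex.abs_re_le_norm _).trans (hM.norm_le ξ)
      rw [Complex.sub_re] at this
      linarith [neg_abs_le ((mollify ψ ξ).re - (ψ ξ).re)]
    have h2 : ‖Complex.exp (-(t : ℂ) * mollify ψ ξ)‖ ≤
        Real.exp (t * M) * Real.exp (-t * (ψ ξ).re) := by
      rw [Complex.norm_exp, ← Real.exp_add, ← Complex.ofReal_neg, Complex.re_ofReal_mul]
      refine Real.exp_le_exp.2 ?_
      nlinarith
    have h3 : (1 + (ψ ξ).re) ^ i ≤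
        i.factorial * (2 / t) ^ i * (Real.exp (t / 2) * Real.exp (t / 2 * (ψ ξ).re)) := by
      have h4 := Real.pow_div_factorial_le_exp (t / 2 * (1 + (ψ ξ).re)) (by positivity) i
      rw [div_le_iff₀ (by positivity), mul_pow] at h4
      rw [← Real.exp_add]
      have h5 : (2 / t) ^ i * (t / 2) ^ i = 1 := by
        rw [← mul_pow]
        field_simp
        simp
      calc (1 + (ψ ξ).re) ^ i = (2 / t) ^ i * ((t / 2) ^ i * (1 + (ψ ξ).re) ^ i) := by
            rw [← mul_assoc, h5, one_mul]
        _ ≤ (2 / t) ^ i * (Real.exp (t / 2 * (1 + (ψ ξ).re)) * i.factorial) := by gcongr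
        _ = _ := by rw [mul_add, mul_one]; ring
    calc ‖Complex.exp (-(t : ℂ) * mollify ψ ξ)‖ * (1 + (ψ ξ).re) ^ i
        ≤ (Real.exp (t * M) * Real.exp (-t * (ψ ξ).re)) *
          (i.factorial * (2 / t) ^ i * (Real.exp (t / 2) * Real.exp (t / 2 * (ψ ξ).re))) := by
          gcongr
      _ = Real.exp (t * M) * (i.factorial * (2 / t) ^ i * Real.exp (t / 2)) *
          (Real.exp (-t * (ψ ξ).re) * Real.exp (t / 2 * (ψ ξ).re)) := by ring
      _ = _ := by
          rw [← Real.exp_add]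
          congr 2
          ring

/-- A real exponent is of bounded oscillation relative to its size, so that its mollification
is dominated by `1 + φ`. -/
theorem IsLevyExponent.hasSymbolBound_mollify {φ : EuclideanSpace ℝ (Fin n) → ℝ}
    (h : IsLevyExponent fun ξ => (φ ξ : ℂ)) :
    HasSymbolBound (mollify fun ξ => (φ ξ : ℂ)) fun ξ => 1 + φ ξ := by
  obtain ⟨M, hM0, hM⟩ := h.exists_bound
  refine ⟨contDiff_mollify h.continuous, fun i => ?_⟩
  obtain ⟨C, hC⟩ := _root_.exists_norm_iteratedFDeriv_mollify_le (n := n) i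
  refine ⟨|C| * (2 + 2 * M), fun ξ => ?_⟩
  have hr : ∀ η, 0 ≤ φ η := fun η => by simpa using h.re_nonneg η
  have h1 := hC _ h.continuous ξ (2 * φ ξ + 2 * M) fun η hη => by
    have h2 := h.re_sub_le ξ η
    have h3 := hM (-η) (by simpa using hη)
    rw [Complex.norm_real, Real.norm_of_nonneg (hr _)]
    simp only [Complex.ofReal_re] at h2
    linarith
  refine h1.trans ?_
  calc C * (2 * φ ξ + 2 * M) ≤ |C| * (2 * φ ξ + 2 * M) :=
        mul_le_mul_of_nonneg_right (le_abs_self C) (by have := hr ξ; positivity)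
    _ ≤ |C| * ((2 + 2 * M) * (1 + φ ξ)) :=
        mul_le_mul_of_nonneg_left (by nlinarith [hr ξ, mul_nonneg hM0 (hr ξ)]) (abs_nonneg C)
    _ = _ := by ring

/-- If `exp (-t Re ψ)` beats every power of `φ`, for all `t > 0`, then `φ ^ m exp (-t ψ)` is the
Fourier transform of an integrable function: after mollification of both exponents it has
integrable derivatives of all orders, and the two corrections are multipliers of `L¹`. -/
theorem isFourierL1_pow_mul_exp {φ : EuclideanSpace ℝ (Fin n) → ℝ} (hψ : IsLevyExponent ψ)
    (hφ : IsLevyExponent fun ξ => (φ ξ : ℂ))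
    (hdec : ∀ t : ℝ, 0 < t → ∀ m : ℕ,
      Integrable fun ξ => (1 + φ ξ) ^ m * Real.exp (-t * (ψ ξ).re))
    {t : ℝ} (ht : 0 < t) (m : ℕ) :
    IsFourierL1 fun ξ => (φ ξ : ℂ) ^ m * Complex.exp (-(t : ℂ) * ψ ξ) := by
  obtain ⟨M, hM⟩ := hψ.exists_isL1Multiplier_mollify_sub
  obtain ⟨M', hM'⟩ := hφ.exists_isL1Multiplier_mollify_sub
  set Φ := mollify fun ξ => (φ ξ : ℂ) with hΦ
  have hsym : ∀ j : ℕ, HasSymbolBound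
      (fun ξ => Φ ξ ^ j * Complex.exp (-(t : ℂ) * mollify ψ ξ))
      (fun ξ => (1 + φ ξ) ^ j * Real.exp (-(t / 2) * (ψ ξ).re)) := fun j => by
    induction j with
    | zero => simpa using hψ.hasSymbolBound_exp_mollify ht
    | succ j ih => simpa only [pow_succ', mul_assoc] using hφ.hasSymbolBound_mollify.mul ih
  have key : ∀ m j : ℕ,
      IsFourierL1 fun ξ => Φ ξ ^ j * ((φ ξ : ℂ) ^ m * Complex.exp (-(t : ℂ) * ψ ξ)) := by
    intro m
    induction m with
    | zero =>
      intro j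
      have h1 := (hsym j).isFourierL1 (hdec (t / 2) (by positivity) j)
      have h2 := ((IsL1Multiplier.const (t : ℂ)).mul hM).cexp.map h1
      convert h2 using 2 with ξ
      rw [pow_zero, one_mul, mul_left_comm, ← Complex.exp_add]
      congr 2
      ring
    | succ m ih =>
      intro j
      convert (ih (j + 1)).sub (hM'.map (ih j)) using 2 with ξ
      simp only [pow_succ]
      ring
  simpa using key m 0

end MollifiedExponent

/-! ### Fourier inversion and densities -/

section Inversion

open scoped FourierTransform

variable {n : ℕ}

theorem fourierInv_eq_fourierTInv (w : EuclideanSpace ℝ (Fin n) → ℂ)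
    (y : EuclideanSpace ℝ (Fin n)) :
    𝓕⁻ w y = fourierTInv w ((2 * Real.pi) • y) := by
  rw [fourierTInv_eq, inv_smul_smul₀ (by positivity)]

theorem IsFourierL1.fourierT_fourierTInv {w : EuclideanSpace ℝ (Fin n) → ℂ} (hw : IsFourierL1 w) :
    fourierT (fourierTInv w) = w := by
  have hpi : (2 * Real.pi) ≠ 0 := by positivity
  have hF : Integrable (𝓕 w) := by
    have h : 𝓕 w = fun y => fourierTInv w (-(2 * Real.pi) • y) := by
      ext y
      rw [neg_smul, ← smul_neg, ← fourierInv_eq_fourierTInv, Real.fourierInv_eq_fourier_neg,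
        neg_neg]
    rw [h]
    exact hw.3.comp_smul (neg_ne_zero.2 hpi)
  have hinv := hw.1.fourier_fourierInv_eq hw.2 hF
  ext ξ
  have h1 := Measure.integral_comp_smul_of_nonneg
    (volume : Measure (EuclideanSpace ℝ (Fin n)))
    (fun y => fourierTInv w y * Complex.exp (-(Complex.I * (inner ℝ y ξ : ℝ))))
    (2 * Real.pi) (hR := by positivity)
  have h2 : ∫ y : EuclideanSpace ℝ (Fin n), fourierTInv w ((2 * Real.pi) • y) *
      Complex.exp (-(Complex.I * (inner ℝ ((2 * Real.pi) • y) ξ : ℝ))) = w ξ := by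
    conv_rhs => rw [← hinv, Real.fourier_eq']
    congr 1 with y
    rw [fourierInv_eq_fourierTInv, smul_eq_mul, mul_comm, real_inner_smul_left]
    congr 2
    push_cast
    ring
  rw [h2, finrank_euclideanSpace_fin] at h1
  rw [fourierT, h1, Complex.real_smul, Complex.ofReal_inv]

theorem fourierTInv_comp_neg (w : EuclideanSpace ℝ (Fin n) → ℂ) (x : EuclideanSpace ℝ (Fin n)) :
    fourierTInv (fun ξ => w (-ξ)) x = fourierTInv w (-x) := by
  rw [fourierTInv, fourierTInv,
    ← integral_neg_eq_self (fun ξ => w ξ * Complex.exp (Complex.I * ((inner ℝ ξ (-x) : ℝ) : ℂ)))]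
  simp

theorem IsFourierL1.comp_neg {w : EuclideanSpace ℝ (Fin n) → ℂ} (hw : IsFourierL1 w) :
    IsFourierL1 fun ξ => w (-ξ) :=
  ⟨hw.1.comp continuous_neg, hw.2.comp_neg, by
    rw [funext (fourierTInv_comp_neg w)]
    exact hw.3.comp_neg⟩

/-- Integration against a measure with a nonnegative density. -/
theorem integral_withDensity_ofReal {p : EuclideanSpace ℝ (Fin n) → ℝ} (hp : Measurable p)
    (hp0 : ∀ x, 0 ≤ p x) (h : EuclideanSpace ℝ (Fin n) → ℂ) :
    ∫ x, h x ∂(volume.withDensity fun x => ENNReal.ofReal (p x)) = ∫ x, (p x : ℂ) * h x := by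
  rw [integral_withDensity_eq_integral_toReal_smul hp.ennreal_ofReal
    (ae_of_all _ fun _ => ENNReal.ofReal_lt_top)]
  simp_rw [ENNReal.toReal_ofReal (hp0 _), Complex.real_smul]

theorem fourierT_density {μ : Measure (EuclideanSpace ℝ (Fin n))}
    {p : EuclideanSpace ℝ (Fin n) → ℝ} (hp : Measurable p) (hp0 : ∀ x, 0 ≤ p x)
    (hμ : μ = volume.withDensity fun x => ENNReal.ofReal (p x)) (ξ : EuclideanSpace ℝ (Fin n)) :
    fourierT (fun x => (p x : ℂ)) ξ = (((2 * Real.pi) ^ n : ℝ) : ℂ)⁻¹ * charFun μ (-ξ) := by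
  rw [fourierT, charFun_apply, hμ, integral_withDensity_ofReal hp hp0]
  congr 2 with x
  rw [inner_neg_right, Complex.ofReal_neg, neg_mul, mul_comm Complex.I]

/-- A probability measure with integrable characteristic function whose inverse transform is also
integrable has that inverse transform as a continuous density. Uniqueness of
characteristic functions identifies `μ + p⁻ dx` with `p⁺ dx`, whence `p⁻ = 0`. -/
theorem exists_density_of_isFourierL1 {μ : Measure (EuclideanSpace ℝ (Fin n))}
    [IsProbabilityMeasure μ] (h : IsFourierL1 (charFun μ)) :
    ∃ p : EuclideanSpace ℝ (Fin n) → ℝ, Continuous p ∧ (∀ x, 0 ≤ p x) ∧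
      μ = volume.withDensity (fun x => ENNReal.ofReal (p x)) ∧
      ∀ x, (p x : ℂ) =
        fourierTInv (fun ξ => (((2 * Real.pi) ^ n : ℝ) : ℂ)⁻¹ * charFun μ (-ξ)) x := by
  set c : ℂ := (((2 * Real.pi) ^ n : ℝ) : ℂ)⁻¹ with hc
  set v : EuclideanSpace ℝ (Fin n) → ℂ := fun ξ => c * charFun μ (-ξ) with hv
  have hvW : IsFourierL1 v := h.comp_neg.const_mul c
  have hconj : ∀ x, (starRingEnd ℂ) (fourierTInv v x) = fourierTInv v x := fun x => by
    rw [fourierTInv, ← integral_conj,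
      ← integral_neg_eq_self (fun ξ => v ξ * Complex.exp (Complex.I * ((inner ℝ ξ x : ℝ) : ℂ)))]
    congr 1 with ξ
    simp only [hv, map_mul, ← Complex.exp_conj, Complex.conj_I, Complex.conj_ofReal, hc, map_inv₀,
      inner_neg_left, charFun_neg, Complex.ofReal_neg, neg_mul, mul_neg, Complex.conj_conj]
  set p : EuclideanSpace ℝ (Fin n) → ℝ := fun x => (fourierTInv v x).re with hp
  have hpF : ∀ x, (p x : ℂ) = fourierTInv v x := fun x => Complex.conj_eq_iff_re.1 (hconj x)
  have hpc : Continuous p := Complex.continuous_re.comp (continuous_fourierTInv hvW.2)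
  have hpi : Integrable p := hvW.3.re
  have hchar : ∀ ξ, charFun μ ξ =
      ∫ x, (p x : ℂ) * Complex.exp ((inner ℝ x ξ : ℝ) * Complex.I) := fun ξ => by
    have h1 := congrFun hvW.fourierT_fourierTInv (-ξ)
    simp only [hv, neg_neg, fourierT, ← hc] at h1
    have hc0 : c ≠ 0 := by
      rw [hc]
      have : (2 * Real.pi) ^ n ≠ 0 := by positivity
      exact inv_ne_zero (by exact_mod_cast this)
    rw [← mul_left_cancel₀ hc0 h1]
    congr 1 with x
    rw [hpF, inner_neg_right, Complex.ofReal_neg, mul_neg, neg_neg, mul_comm Complex.I]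
  have hfin : ∀ q : EuclideanSpace ℝ (Fin n) → ℝ, Integrable q →
      IsFiniteMeasure (volume.withDensity fun x => ENNReal.ofReal (q x)) := fun q hq =>
    isFiniteMeasure_withDensity_ofReal hq.2
  have hmax : ∀ q : EuclideanSpace ℝ (Fin n) → ℝ, (fun x => ENNReal.ofReal (q x)) =
      fun x => ENNReal.ofReal (max (q x) 0) := fun q => by
    ext x
    rcases le_total (q x) 0 with h | h <;> simp [h, ENNReal.ofReal_of_nonpos]
  have hsum : μ + volume.withDensity (fun x => ENNReal.ofReal (-p x)) =
      volume.withDensity fun x => ENNReal.ofReal (p x) := by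
    have := hfin p hpi
    have := hfin (fun x => -p x) hpi.neg
    refine Measure.ext_of_charFun (funext fun ξ => ?_)
    have hei : ∀ (ν : Measure (EuclideanSpace ℝ (Fin n))) [IsFiniteMeasure ν],
        Integrable (fun x => Complex.exp ((inner ℝ x ξ : ℝ) * Complex.I)) ν := fun ν _ => by
      refine (integrable_const (1 : ℝ)).mono' (Continuous.aestronglyMeasurable (by fun_prop)) ?_
      exact ae_of_all _ fun y => by rw [Complex.norm_exp_ofReal_mul_I]
    have hqi : ∀ q : EuclideanSpace ℝ (Fin n) → ℝ, Integrable q →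
        Integrable fun x => ((max (q x) 0 : ℝ) : ℂ) *
          Complex.exp ((inner ℝ x ξ : ℝ) * Complex.I) := fun q hq => by
      refine hq.pos_part.ofReal.mul_bdd (c := 1) (Continuous.aestronglyMeasurable (by fun_prop)) ?_
      exact ae_of_all _ fun y => by rw [Complex.norm_exp_ofReal_mul_I]
    have hq : ∀ q : EuclideanSpace ℝ (Fin n) → ℝ, Measurable q →
        charFun (volume.withDensity fun x => ENNReal.ofReal (q x)) ξ =
          ∫ x, ((max (q x) 0 : ℝ) : ℂ) * Complex.exp ((inner ℝ x ξ : ℝ) * Complex.I) :=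
      fun q hq => by
        rw [charFun_apply, hmax q, integral_withDensity_ofReal (hq.max measurable_const)
          fun x => le_max_right _ _]
    have hpe : Integrable fun x => (p x : ℂ) * Complex.exp ((inner ℝ x ξ : ℝ) * Complex.I) := by
      refine hpi.ofReal.mul_bdd (c := 1) (Continuous.aestronglyMeasurable (by fun_prop)) ?_
      exact ae_of_all _ fun y => by rw [Complex.norm_exp_ofReal_mul_I]
    have hadd : charFun (μ + volume.withDensity fun x => ENNReal.ofReal (-p x)) ξ =
        charFun μ ξ + charFun (volume.withDensity fun x => ENNReal.ofReal (-p x)) ξ :=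
      integral_add_measure (hei μ) (hei _)
    rw [hadd, hq _ hpc.measurable, hq (fun x => -p x) hpc.measurable.neg, hchar,
      ← integral_add hpe (hqi (fun x => -p x) hpi.neg)]
    congr 1 with x
    rw [← add_mul, ← Complex.ofReal_add]
    congr 2
    rcases le_total (p x) 0 with h | h <;> simp [h]
  have hp0 : ∀ x, 0 ≤ p x := by
    set A : Set (EuclideanSpace ℝ (Fin n)) := {x | p x < 0} with hA
    have hAo : IsOpen A := isOpen_lt hpc continuous_const
    have h1 : (volume.withDensity fun x => ENNReal.ofReal (p x)) A = 0 := by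
      rw [withDensity_apply _ hAo.measurableSet]
      refine (setLIntegral_congr_fun hAo.measurableSet (g := fun _ => 0) fun x hx => ?_).trans
        (by simp)
      exact ENNReal.ofReal_of_nonpos (le_of_lt hx)
    rw [← hsum, Measure.add_apply, add_eq_zero] at h1
    have h2 := h1.2
    rw [withDensity_apply_eq_zero (by fun_prop)] at h2
    have h3 : {x | ENNReal.ofReal (-p x) ≠ 0} ∩ A = A := by
      refine Set.inter_eq_right.2 fun x hx => ?_
      have : p x < 0 := hx
      simpa using this
    rw [h3, hAo.measure_eq_zero_iff volume] at h2
    intro x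
    by_contra hx
    have : x ∈ A := not_le.1 hx
    rw [h2] at this
    exact this
  refine ⟨p, hpc, hp0, ?_, hpF⟩
  rw [← hsum]
  have : (fun x => ENNReal.ofReal (-p x)) = 0 := by
    ext x
    simpa using hp0 x
  rw [this, withDensity_zero, add_zero]

end Inversion

/-! ### Growth of the symmetric exponent -/

section Growth

variable {n : ℕ} {φ : EuclideanSpace ℝ (Fin n) → ℝ} {κ : ℝ}

theorem integrable_rpow_of_memLp (hφ0 : ∀ ξ, 0 ≤ φ ξ)
    (hint : MemLp (fun ξ => (1 + φ ξ) ^ (-κ / 2)) 2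
      (volume : Measure (EuclideanSpace ℝ (Fin n)))) :
    Integrable fun ξ => (1 + φ ξ) ^ (-κ) := by
  refine hint.integrable_sq.congr (ae_of_all _ fun ξ => ?_)
  have := hφ0 ξ
  simp only
  rw [← Real.rpow_natCast, ← Real.rpow_mul (by positivity)]
  congr 1
  push_cast
  ring

/-- An exponent with `(1 + φ) ^ (-κ)` integrable tends to infinity: where `φ` is small, it is
small on a ball of radius one, and the integral over such balls tends to zero. -/
theorem tendsto_atTop_of_integrable_rpow (hφ : IsLevyExponent fun ξ => (φ ξ : ℂ)) (hκ : 0 < κ)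
    (hint : Integrable fun ξ => (1 + φ ξ) ^ (-κ)) :
    Tendsto φ (cocompact (EuclideanSpace ℝ (Fin n))) atTop := by
  have hφ0 : ∀ ξ, 0 ≤ φ ξ := fun ξ => by simpa using hφ.re_nonneg ξ
  obtain ⟨M, hM0, hM⟩ := hφ.exists_bound
  set B : EuclideanSpace ℝ (Fin n) → Set (EuclideanSpace ℝ (Fin n)) :=
    fun ξ => Metric.closedBall ξ 1 with hB
  have hlim : Tendsto (fun ξ => ∫ η in B ξ, (1 + φ η) ^ (-κ))
      (cocompact (EuclideanSpace ℝ (Fin n))) (𝓝 0) := by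
    have h : (fun ξ => ∫ η in B ξ, (1 + φ η) ^ (-κ)) =
        fun ξ => ∫ η, (B ξ).indicator (fun η => (1 + φ η) ^ (-κ)) η := funext fun ξ =>
      (integral_indicator Metric.isClosed_closedBall.measurableSet).symm
    have : (cocompact (EuclideanSpace ℝ (Fin n))).IsCountablyGenerated := by
      rw [← Metric.cobounded_eq_cocompact, ← comap_norm_atTop]
      infer_instance
    rw [h, ← integral_zero (EuclideanSpace ℝ (Fin n)) ℝ]
    refine tendsto_integral_filter_of_dominated_convergence
      (fun η => ‖(1 + φ η) ^ (-κ)‖) ?_ ?_ hint.norm ?_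
    · exact Eventually.of_forall fun ξ =>
        hint.aestronglyMeasurable.indicator Metric.isClosed_closedBall.measurableSet
    · exact Eventually.of_forall fun ξ => ae_of_all _ fun η => norm_indicator_le_norm_self _ _
    · refine ae_of_all _ fun η => ?_
      refine tendsto_const_nhds.congr' ?_
      filter_upwards [(isCompact_closedBall η 1).compl_mem_cocompact] with ξ hξ
      refine (Set.indicator_of_notMem (fun h => hξ ?_) _).symm
      exact Metric.mem_closedBall_comm.1 h
  rw [tendsto_atTop]
  intro b
  set m : ℝ := 1 + (2 * max b 0 + 2 * M) with hm
  have hm0 : 0 < m := by positivity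
  have hV : 0 < volume.real (B (0 : EuclideanSpace ℝ (Fin n))) :=
    ENNReal.toReal_pos (Metric.measure_closedBall_pos volume _ one_pos).ne'
      (isCompact_closedBall _ _).measure_ne_top
  have hc : 0 < m ^ (-κ) * volume.real (B (0 : EuclideanSpace ℝ (Fin n))) := by positivity
  filter_upwards [hlim.eventually (gt_mem_nhds hc)] with ξ hξ
  by_contra! hb
  refine hξ.not_ge ?_
  have h1 : ∀ η ∈ B ξ, m ^ (-κ) ≤ (1 + φ η) ^ (-κ) := fun η hη => by
    have h2 := hφ.re_sub_le ξ (ξ - η)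
    have h3 := hM (-(ξ - η)) (by
      rw [norm_neg, ← dist_eq_norm]
      exact Metric.mem_closedBall'.1 hη)
    simp only [sub_sub_cancel, Complex.ofReal_re] at h2
    refine Real.rpow_le_rpow_of_nonpos (by have := hφ0 η; positivity) ?_ (by linarith)
    have := le_max_left b 0
    linarith
  have h2 : volume.real (B ξ) = volume.real (B (0 : EuclideanSpace ℝ (Fin n))) := by
    simp only [hB, Measure.real, Measure.addHaar_closedBall_center]
  calc m ^ (-κ) * volume.real (B 0) = ∫ _ in B ξ, m ^ (-κ) := by
        rw [setIntegral_const, smul_eq_mul, h2, mul_comm]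
    _ ≤ ∫ η in B ξ, (1 + φ η) ^ (-κ) :=
        setIntegral_mono_on
          (integrableOn_const (isCompact_closedBall _ _).measure_ne_top) hint.integrableOn
          Metric.isClosed_closedBall.measurableSet h1

/-- If `Re ψ / log (1 + φ)` tends to infinity, then `exp (-t Re ψ)` beats every power of `φ`. -/
theorem integrable_pow_mul_exp_of_tendsto {ψ : EuclideanSpace ℝ (Fin n) → ℂ}
    (hψ : IsLevyExponent ψ) (hφ : IsLevyExponent fun ξ => (φ ξ : ℂ))
    (hint : Integrable fun ξ => (1 + φ ξ) ^ (-κ))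
    (h : Tendsto (fun ξ => (ψ ξ).re / Real.log (1 + φ ξ))
      (cocompact (EuclideanSpace ℝ (Fin n))) atTop) {t : ℝ} (ht : 0 < t) (m : ℕ) :
    Integrable fun ξ => (1 + φ ξ) ^ m * Real.exp (-t * (ψ ξ).re) := by
  have hφ0 : ∀ ξ, 0 ≤ φ ξ := fun ξ => by simpa using hφ.re_nonneg ξ
  have hφc : Continuous φ := Complex.continuous_re.comp hφ.continuous
  have hψc : Continuous fun ξ => (ψ ξ).re := Complex.continuous_re.comp hψ.continuous
  have hcont : Continuous fun ξ => (1 + φ ξ) ^ m * Real.exp (-t * (ψ ξ).re) := by fun_prop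
  obtain ⟨K, hK, hKs⟩ := mem_cocompact.1 (h.eventually (eventually_ge_atTop ((m + κ) / t)))
  rw [← integrableOn_univ, ← Set.union_compl_self K]
  refine (hcont.continuousOn.integrableOn_compact hK).union ?_
  refine hint.integrableOn.mono' hcont.aestronglyMeasurable ?_
  refine (ae_restrict_mem hK.measurableSet.compl).mono fun ξ hξ => ?_
  have h1 : (m + κ) / t ≤ (ψ ξ).re / Real.log (1 + φ ξ) := hKs hξ
  have hp := hφ0 ξ
  have hpos : 0 < 1 + φ ξ := by positivity
  have h2 : (m + κ) * Real.log (1 + φ ξ) ≤ t * (ψ ξ).re := by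
    rcases (Real.log_nonneg (le_add_of_nonneg_right hp : (1 : ℝ) ≤ 1 + φ ξ)).eq_or_lt with h0 | h0
    · rw [← h0, mul_zero]
      exact mul_nonneg ht.le (hψ.re_nonneg ξ)
    · rw [div_le_div_iff₀ ht h0] at h1
      linarith
  rw [Real.norm_of_nonneg (by positivity), ← Real.rpow_natCast, Real.rpow_def_of_pos hpos,
    Real.rpow_def_of_pos hpos, ← Real.exp_add]
  refine Real.exp_le_exp.2 ?_
  linarith

end Growth

/-! ### Smooth densities from the growth condition -/

section Direct

variable {n : ℕ}

theorem IsLevyExponent.even_of_real {φ : EuclideanSpace ℝ (Fin n) → ℝ}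
    (h : IsLevyExponent fun ξ => (φ ξ : ℂ)) (ξ : EuclideanSpace ℝ (Fin n)) : φ (-ξ) = φ ξ := by
  obtain ⟨μ, -, hc⟩ := h
  have h1 := charFun_neg (μ := μ 1) ξ
  rw [hc, hc, ← Complex.exp_conj] at h1
  have h2 : Real.exp (-φ (-ξ)) = Real.exp (-φ ξ) := by
    have : ((Real.exp (-φ (-ξ)) : ℝ) : ℂ) = (Real.exp (-φ ξ) : ℝ) := by
      push_cast
      simpa using h1
    exact_mod_cast this
  linarith [Real.exp_injective h2]

/-- If `Φ · fourierT u` is integrable, the function given by its inverse Fourier integral is the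
distribution `Φ(D) u`. -/
theorem isMultiplierImage_fourierTInv {Φ : EuclideanSpace ℝ (Fin n) → ℝ}
    {u v : EuclideanSpace ℝ (Fin n) → ℂ} (hv : Integrable v)
    (h : ∀ ξ, (Φ ξ : ℂ) * fourierT u ξ = v ξ) : IsMultiplierImage Φ u (fourierTInv v) := by
  intro η
  have hη : Integrable (fun y => η y) := η.integrable
  simp_rw [h]
  refine ⟨?_, ?_, integral_fourierTInv_mul hη hv⟩
  · exact hη.bdd_mul (c := ∫ ξ, ‖v ξ‖) (continuous_fourierTInv hv).aestronglyMeasurable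
      (ae_of_all _ (norm_fourierTInv_le v))
  · exact hv.mul_bdd (c := ∫ y, ‖η y‖) (continuous_fourierTInv hη).aestronglyMeasurable
      (ae_of_all _ (norm_fourierTInv_le _))

/-- The density `p`, and with it each `φ(D) ^ m p`, is the inverse Fourier integral of
`φ ^ m exp (-t ψ)`, up to reflection and normalization. -/
theorem exists_density_multiplierImage {Ω : Type*} [MeasurableSpace Ω] {P : Measure Ω}
    [IsProbabilityMeasure P] {X : ℝ≥0 → Ω → EuclideanSpace ℝ (Fin n)} (hX : IsLevyProcess X P)
    {ψ : EuclideanSpace ℝ (Fin n) → ℂ} (hψ : IsCharExponent X P ψ)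
    {φ : EuclideanSpace ℝ (Fin n) → ℝ} (hφ : IsLevyExponent fun ξ => (φ ξ : ℂ)) {t : ℝ≥0}
    (hw : ∀ m : ℕ, IsFourierL1 fun ξ => (φ ξ : ℂ) ^ m * Complex.exp (-((t : ℝ) : ℂ) * ψ ξ)) :
    ∃ p : EuclideanSpace ℝ (Fin n) → ℝ,
      IsTransitionDensity X P t p ∧ VanishesContinuously p ∧
      ∀ m : ℕ, ∃ g : EuclideanSpace ℝ (Fin n) → ℂ,
        IsMultiplierImage (fun ξ => φ ξ ^ m) (fun x => (p x : ℂ)) g ∧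
        Integrable g ∧ VanishesContinuously g := by
  have : IsProbabilityMeasure (P.map (X t)) :=
    Measure.isProbabilityMeasure_map (hX.measurable t).aemeasurable
  have hW : IsFourierL1 (charFun (P.map (X t))) := by
    rw [funext (hψ t)]
    simpa using hw 0
  obtain ⟨p, hpc, hp0, hpμ, hpF⟩ := exists_density_of_isFourierL1 hW
  refine ⟨p, ⟨hpc.measurable, hp0, hpμ⟩, ⟨hpc, ?_⟩, fun m => ?_⟩
  · have h1 := (Complex.continuous_re.tendsto 0).comp (tendsto_fourierTInv (n := n)
      fun ξ => (((2 * Real.pi) ^ n : ℝ) : ℂ)⁻¹ * charFun (P.map (X t)) (-ξ))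
    refine h1.congr fun x => ?_
    rw [Function.comp, ← hpF, Complex.ofReal_re]
  · have hv := ((hw m).comp_neg).const_mul (((2 * Real.pi) ^ n : ℝ) : ℂ)⁻¹
    refine ⟨_, isMultiplierImage_fourierTInv hv.2 fun ξ => ?_, hv.3,
      continuous_fourierTInv hv.2, tendsto_fourierTInv _⟩
    rw [fourierT_density hpc.measurable hp0 hpμ, hψ, hφ.even_of_real, Complex.ofReal_pow]
    ring

end Direct

/-! ### The growth condition from integrability -/

section Converse

open scoped FourierTransform

variable {n : ℕ}

/-- Every test function is the inverse Fourier transform of a Schwartz function, namely of its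
Fourier transform. -/
theorem exists_schwartzMap_eq_fourierT {θ : EuclideanSpace ℝ (Fin n) → ℂ}
    (hθ : ContDiff ℝ (⊤ : ℕ∞) θ) (hθs : HasCompactSupport θ) :
    ∃ η : 𝓢(EuclideanSpace ℝ (Fin n), ℂ), (∀ y, η y = fourierT θ y) ∧
      ∀ ξ, fourierTInv (fun y => η y) ξ = θ ξ := by
  have hpi : (2 * Real.pi) ≠ 0 := by positivity
  have hs : HasCompactSupport fun x : EuclideanSpace ℝ (Fin n) => θ ((2 * Real.pi) • x) :=
    hθs.comp_smul hpi
  have hd : ContDiff ℝ (⊤ : ℕ∞)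
      fun x : EuclideanSpace ℝ (Fin n) => θ ((2 * Real.pi) • x) := by fun_prop
  set S := hs.toSchwartzMap hd with hS
  have hSx : ∀ x, S x = θ ((2 * Real.pi) • x) := fun x => rfl
  refine ⟨𝓕 S, fun y => ?_, fun ξ => ?_⟩
  · have h1 := Measure.integral_comp_smul_of_nonneg
      (volume : Measure (EuclideanSpace ℝ (Fin n)))
      (fun x => θ x * Complex.exp (-(Complex.I * (inner ℝ x y : ℝ))))
      (2 * Real.pi) (hR := by positivity)
    rw [finrank_euclideanSpace_fin, Complex.real_smul, Complex.ofReal_inv] at h1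
    rw [fourierT, ← h1, SchwartzMap.fourier_coe, Real.fourier_eq']
    congr 1 with x
    rw [hSx, smul_eq_mul, mul_comm, real_inner_smul_left]
    congr 2
    push_cast
    ring
  · rw [fourierTInv_eq, SchwartzMap.fourier_coe,
      S.continuous.fourierInv_fourier_eq S.integrable (by
        rw [← SchwartzMap.fourier_coe]
        exact (𝓕 S).integrable), hSx, smul_inv_smul₀ hpi]

/-- The distributional identity `g = Φ(D) u` between integrable functions is an identity of their
Fourier transforms. -/
theorem IsMultiplierImage.mul_fourierT_eq {Φ : EuclideanSpace ℝ (Fin n) → ℝ} (hΦ : Continuous Φ)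
    {u g : EuclideanSpace ℝ (Fin n) → ℂ} (hu : Integrable u) (hg : Integrable g)
    (h : IsMultiplierImage Φ u g) (ξ : EuclideanSpace ℝ (Fin n)) :
    (Φ ξ : ℂ) * fourierT u ξ = fourierT g ξ := by
  have hcont : ∀ {f : EuclideanSpace ℝ (Fin n) → ℂ}, Integrable f → Continuous (fourierT f) :=
    fun hf => by
      rw [funext (fourierT_eq_fourierTInv_neg _)]
      exact ((continuous_fourierTInv hf).comp continuous_neg).const_mul _
  have h1 : Continuous fun ξ => (Φ ξ : ℂ) * fourierT u ξ := by
    have := hcont hu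
    fun_prop
  refine congrFun ((h1.ae_eq_iff_eq volume (hcont hg)).1
    (ae_eq_of_integral_contDiff_smul_eq h1.locallyIntegrable (hcont hg).locallyIntegrable
      fun θ hθ hθs => ?_)) ξ
  have hθc : HasCompactSupport fun x => (θ x : ℂ) := hθs.comp_left Complex.ofReal_zero
  have hθd : ContDiff ℝ (⊤ : ℕ∞) fun x => (θ x : ℂ) := Complex.ofRealCLM.contDiff.comp hθ
  have hθi : Integrable fun x => (θ x : ℂ) := hθd.continuous.integrable_of_hasCompactSupport hθc
  obtain ⟨η, hη1, hη2⟩ := exists_schwartzMap_eq_fourierT hθd hθc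
  have h2 := (h η).2.2
  simp_rw [hη2, hη1] at h2
  calc ∫ x, θ x • ((Φ x : ℂ) * fourierT u x) = ∫ x, (Φ x : ℂ) * fourierT u x * (θ x : ℂ) := by
        congr 1 with x
        rw [Complex.real_smul, mul_comm]
    _ = ∫ x, g x * fourierT (fun y => (θ y : ℂ)) x := h2.symm
    _ = ∫ x, θ x • fourierT g x := by
        simp_rw [fourierT_eq_fourierTInv_neg, Complex.real_smul]
        have h3 := integral_fourierTInv_mul hg.comp_neg hθi
        rw [← integral_neg_eq_self (fun x => fourierTInv (fun y => (θ y : ℂ)) x * g (-x))] at h3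
        simp only [neg_neg, fourierTInv_comp_neg] at h3
        simp_rw [mul_left_comm _ ((((2 * Real.pi) ^ n : ℝ) : ℂ)⁻¹)]
        rw [integral_const_mul, integral_const_mul, ← h3]
        congr 2 with x
        ring

/-- By the Riemann–Lebesgue lemma `φ exp (-t Re ψ)`, the modulus of a Fourier transform of an
integrable function, tends to zero. This bounds `Re ψ / log (1 + φ)` from below by `1 / t` near
infinity, for every `t > 0`. -/
theorem tendsto_div_log_of_multiplierImage {Ω : Type*} [MeasurableSpace Ω] {P : Measure Ω}
    {X : ℝ≥0 → Ω → EuclideanSpace ℝ (Fin n)}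
    {ψ : EuclideanSpace ℝ (Fin n) → ℂ} (hψ : IsCharExponent X P ψ)
    {φ : EuclideanSpace ℝ (Fin n) → ℝ} (hφc : Continuous φ)
    (hφ : Tendsto φ (cocompact (EuclideanSpace ℝ (Fin n))) atTop)
    (h : ∀ t : ℝ≥0, 0 < t → ∃ p : EuclideanSpace ℝ (Fin n) → ℝ,
        IsTransitionDensity X P t p ∧ Integrable p ∧
        ∃ g : EuclideanSpace ℝ (Fin n) → ℂ,
          IsMultiplierImage φ (fun x => (p x : ℂ)) g ∧ Integrable g) :
    Tendsto (fun ξ => (ψ ξ).re / Real.log (1 + φ ξ))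
        (cocompact (EuclideanSpace ℝ (Fin n))) atTop := by
  rw [tendsto_atTop]
  intro b
  set t : ℝ≥0 := (Real.toNNReal (max b 1))⁻¹ with ht
  have ht0 : 0 < t := by
    rw [ht, inv_pos, Real.toNNReal_pos]
    exact lt_max_of_lt_right one_pos
  have hbt : b * t ≤ 1 := by
    rw [ht, NNReal.coe_inv, Real.coe_toNNReal _ (zero_le_one.trans (le_max_right _ _)),
      ← div_eq_mul_inv, div_le_one (lt_max_of_lt_right one_pos)]
    exact le_max_left _ _
  obtain ⟨p, ⟨hpm, hp0, hpμ⟩, hpi, g, hg, hgi⟩ := h t ht0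
  have heq : ∀ ξ, (φ ξ : ℂ) * fourierT (fun x => (p x : ℂ)) ξ = fourierT g ξ :=
    hg.mul_fourierT_eq hφc hpi.ofReal hgi
  set c : ℂ := (((2 * Real.pi) ^ n : ℝ) : ℂ)⁻¹ with hc
  have hc0 : 0 < ‖c‖ := norm_pos_iff.2 (by
    have : (2 * Real.pi) ^ n ≠ 0 := by positivity
    exact inv_ne_zero (by exact_mod_cast this))
  have hnorm : ∀ ξ, ‖charFun (P.map (X t)) (-ξ)‖ = Real.exp (-t * (ψ ξ).re) := fun ξ => by
    rw [charFun_neg, RCLike.norm_conj, hψ, Complex.norm_exp, ← Complex.ofReal_neg,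
      Complex.re_ofReal_mul]
  have hval : ∀ ξ, ‖c‖ * (|φ ξ| * Real.exp (-t * (ψ ξ).re)) = ‖c‖ * ‖fourierTInv g (-ξ)‖ :=
    fun ξ => by
      have h1 := congrArg norm (heq ξ)
      rw [fourierT_density hpm hp0 hpμ, fourierT_eq_fourierTInv_neg] at h1
      simp only [← hc, norm_mul, hnorm, Complex.norm_real, Real.norm_eq_abs] at h1
      linarith
  have hRL : Tendsto (fun ξ => ‖fourierTInv g (-ξ)‖) (cocompact (EuclideanSpace ℝ (Fin n)))
      (𝓝 0) := by
    have := ((tendsto_fourierTInv g).comp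
      (Homeomorph.neg (EuclideanSpace ℝ (Fin n))).isClosedEmbedding.tendsto_cocompact).norm
    simpa using this
  filter_upwards [hRL.eventually (gt_mem_nhds (by norm_num : (0 : ℝ) < 1 / 2)),
    hφ.eventually (eventually_ge_atTop 1)] with ξ h1 h2
  have h3 := mul_left_cancel₀ hc0.ne' (hval ξ)
  rw [abs_of_nonneg (by linarith)] at h3
  have hlog : 0 < Real.log (1 + φ ξ) := Real.log_pos (by linarith)
  have h4 : (1 + φ ξ) * Real.exp (-t * (ψ ξ).re) ≤ 1 := by
    nlinarith [Real.exp_pos (-t * (ψ ξ).re)]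
  have h5 : Real.log (1 + φ ξ) ≤ t * (ψ ξ).re := by
    have h6 := Real.log_nonpos (by positivity) h4
    rw [Real.log_mul (by linarith) (Real.exp_ne_zero _), Real.log_exp] at h6
    linarith
  rw [le_div_iff₀ hlog]
  have ht0' : (0 : ℝ) < t := ht0
  rcases le_total b 0 with hb | hb
  · refine (mul_nonpos_of_nonpos_of_nonneg hb hlog.le).trans ?_
    exact nonneg_of_mul_nonneg_right (hlog.le.trans h5) ht0'
  · calc b * Real.log (1 + φ ξ) ≤ b * (t * (ψ ξ).re) := mul_le_mul_of_nonneg_left h5 hb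
      _ = (b * t) * (ψ ξ).re := by ring
      _ ≤ 1 * (ψ ξ).re := by
          refine mul_le_mul_of_nonneg_right hbt ?_
          exact nonneg_of_mul_nonneg_right (hlog.le.trans h5) ht0'
      _ = _ := one_mul _

end Converse

theorem theorem4 {n : ℕ} (hn : 1 ≤ n)
    {Ω : Type*} [MeasurableSpace Ω] (P : Measure Ω) [IsProbabilityMeasure P]
    (X : ℝ≥0 → Ω → EuclideanSpace ℝ (Fin n)) (hX : IsLevyProcess X P)
    (ψ : EuclideanSpace ℝ (Fin n) → ℂ) (hψ : IsCharExponent X P ψ)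
    {Ω' : Type*} [MeasurableSpace Ω'] (P' : Measure Ω') [IsProbabilityMeasure P']
    (Y : ℝ≥0 → Ω' → EuclideanSpace ℝ (Fin n)) (hY : IsLevyProcess Y P')
    (hYsymm : IsSymmetricProcess Y P')
    (φ : EuclideanSpace ℝ (Fin n) → ℝ) (hφ : IsCharExponent Y P' fun ξ => (φ ξ : ℂ))
    (κ : ℝ) (hκ : 0 < κ)
    (hint : MemLp (fun ξ => (1 + φ ξ) ^ (-κ / 2)) 2
      (volume : Measure (EuclideanSpace ℝ (Fin n)))) :
    List.TFAE [
      Tendsto (fun ξ => (ψ ξ).re / Real.log (1 + φ ξ))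
        (cocompact (EuclideanSpace ℝ (Fin n))) atTop,
      ∀ t : ℝ≥0, 0 < t → ∃ p : EuclideanSpace ℝ (Fin n) → ℝ,
        IsTransitionDensity X P t p ∧ VanishesContinuously p ∧
        ∀ m : ℕ, ∃ g : EuclideanSpace ℝ (Fin n) → ℂ,
          IsMultiplierImage (fun ξ => φ ξ ^ m) (fun x => (p x : ℂ)) g ∧
          Integrable g ∧ VanishesContinuously g,
      ∀ t : ℝ≥0, 0 < t → ∃ p : EuclideanSpace ℝ (Fin n) → ℝ,
        IsTransitionDensity X P t p ∧ Integrable p ∧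
        ∃ g : EuclideanSpace ℝ (Fin n) → ℂ,
          IsMultiplierImage φ (fun x => (p x : ℂ)) g ∧ Integrable g] := by
  have hψL := hψ.isLevyExponent hX
  have hφL := hφ.isLevyExponent hY
  have hφ0 : ∀ ξ, 0 ≤ φ ξ := fun ξ => by simpa using hφL.re_nonneg ξ
  have hφc : Continuous φ := Complex.continuous_re.comp hφL.continuous
  have hint' := integrable_rpow_of_memLp hφ0 hint
  tfae_have 1 → 2 := fun h t ht =>
    exists_density_multiplierImage hX hψ hφL (isFourierL1_pow_mul_exp hψL hφL
      (fun s hs m => integrable_pow_mul_exp_of_tendsto hψL hφL hint' h hs m)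
      (NNReal.coe_pos.2 ht))
  tfae_have 2 → 3 := fun h t ht => by
    obtain ⟨p, hp, -, hg⟩ := h t ht
    obtain ⟨g, hg1, hg2, -⟩ := hg 1
    refine ⟨p, hp, ?_, g, by simpa using hg1, hg2⟩
    have : IsProbabilityMeasure (P.map (X t)) :=
      Measure.isProbabilityMeasure_map (hX.measurable t).aemeasurable
    refine ⟨hp.1.aestronglyMeasurable, ?_⟩
    rw [hasFiniteIntegral_iff_ofReal (ae_of_all _ hp.2.1), ← setLIntegral_univ,
      ← withDensity_apply _ MeasurableSet.univ, ← hp.2.2]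
    exact measure_lt_top _ _
  tfae_have 3 → 1 := fun h =>
    tendsto_div_log_of_multiplierImage hψ hφc
      (tendsto_atTop_of_integrable_rpow hφL hκ hint') h
  tfae_finish
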